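/- Identify $\mathbb{C}^2$ with $\mathbb{R}^4$ by $(z_1,z_2)\leftrightarrow(x_1,y_1,x_2,y_2)$, $z_j=x_j+iy_j$, with the Euclidean norm and the orientation given by these coordinates. A mixed polynomial is a complex polynomial $f(\mathbf z,\bar{\mathbf z})$ in $z_1,z_2,\bar z_1,\bar z_2$; write $f=f_R+if_I$ for its real and imaginary parts. The curve $C=\{f=0\}$ is mixed non-singular at $P\in C$ if the real Jacobian matrix of $(f_R,f_I)$ has rank $2$ at $P$; then a frame $(v_1,v_2)$ of $T_PC$ is called positive if $\det(v_1,v_2,\operatorname{grad} f_R(P),\operatorname{grad} f_I(P))>0$. If $C=\{f=0\}$ and $C'=\{g=0\}$ are mixed non-singular at $P\in C\cap C'$ and meet transversely there, $P$ is a positive (negative) intersection point if $\det(u_1,u_2,v_1,v_2)>0$ (respectively $<0$) for positive frames $(u_1,u_2)$ of $T_PC$ and $(v_1,v_2)$ of $T_PC'$. If $P$ is an isolated point of $C\cap C'$, the local intersection number $I_{top}(C,C';P)\in\mathbb{Z}$ is the mapping degree of $$\varphi/\|\varphi\|\colon S^3_\varepsilon(P)=\{x:\|x-P\|=\varepsilon\}\to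 S^3,\qquad \varphi=(f_R,f_I,g_R,g_I),$$ for any $\varepsilon>0$ such that $P$ is the only point of $C\cap C'$ in the closed ball $B_\varepsilon(P)$ (the degree is the same for all such $\varepsilon$). **Theorem.** Let $C=\{f=0\}$ and $C'=\{g=0\}$ be mixed curves in $\mathbb{C}^2$, and let $\varepsilon>0$ be such that $C\cap C'\cap B_\varepsilon(P)=\{P\}$, where $B_\varepsilon(P)$ is the closed ball. Let $f_t$, $g_t$, $|t|\le\rho$ ($t$ a real or a complex parameter), be families of mixed polynomials such that $f_t(\mathbf z,\bar{\mathbf z})$ and $g_t(\mathbf z,\bar{\mathbf z})$ are continuous in $(t,\mathbf z)$, with $f_0=f$ and $g_0=g$; put $C_t=\{f_t=0\}$ and $C'_s=\{g_s=0\}$. Let $0<\gamma\le\rho$ be such that $C_\alpha\cap C'_\beta\cap S^3_\varepsilon(P)=\emptyset$ whenever $|\alpha|,|\beta|\le\gamma$. Let $|\delta|,|\delta'|\le\gamma$, and suppose that $C_\delta\cap C'_{\delta'}\cap B_\varepsilon(P)=\{P_1,\dots,P_\nu\}$ with $\nu\ge 0$ distinct points, and that at each $P_j$ both $C_\delta$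 and $C'_{\delta'}$ are mixed non-singular and meet transversely. Let $a$ and $b$ be the numbers of positive and of negative intersection points of $C_\delta$ and $C'_{\delta'}$ among $P_1,\dots,P_\nu$. Then $a+b=\nu$ and $$I_{top}(C,C';P)=a-b.$$ -/

import Mathlib

open scoped ContDiff ComplexConjugate

noncomputable section

namespace MixedCurve

/-- `ℝ⁴` with its Euclidean norm, identified with `ℂ²` by
`(x₁, y₁, x₂, y₂) ↔ (x₁ + i y₁, x₂ + i y₂)`. -/
abbrev R4 : Type := EuclideanSpace ℝ (Fin 4)

/-- The point `(z₁, z₂)` of `ℂ²` with real coordinates `(x₁, y₁, x₂, y₂)`. -/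
def toC2 (x : R4) : Fin 2 → ℂ := ![⟨x 0, x 1⟩, ⟨x 2, x 3⟩]

/-- Mixed polynomials in two variables: complex polynomials in `z₁, z₂` (the variables `inl j`)
and in their conjugates (the variables `inr j`). -/
abbrev MixedPolynomial : Type := MvPolynomial (Fin 2 ⊕ Fin 2) ℂ

/-- The value of a mixed polynomial at a point of `ℂ² = ℝ⁴`. -/
def MixedPolynomial.value (f : MixedPolynomial) (x : R4) : ℂ :=
  MvPolynomial.eval (Sum.elim (fun j => toC2 x j) (fun j => conj (toC2 x j))) f

/-- The mixed curve `{f = 0}`. -/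
def curve (f : MixedPolynomial) : Set R4 := {x | f.value x = 0}

/-- The gradient of the real part of `f`. -/
def gradRe (f : MixedPolynomial) (P : R4) : R4 := gradient (fun x => (f.value x).re) P

/-- The gradient of the imaginary part of `f`. -/
def gradIm (f : MixedPolynomial) (P : R4) : R4 := gradient (fun x => (f.value x).im) P

/-- The curve `{f = 0}` is mixed non-singular at its point `P`: the real Jacobian matrix of the
real and imaginary parts of `f` has rank two at `P`. -/
def MixedNonsingularAt (f : MixedPolynomial) (P : R4) : Prop :=
  P ∈ curve f ∧ LinearIndependent ℝ ![gradRe f P, gradIm f P]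

/-- The tangent plane at `P` of the curve `{f = 0}`, the kernel of the real differential of `f`
(meaningful where the curve is mixed non-singular). -/
def tangentPlane (f : MixedPolynomial) (P : R4) : Submodule ℝ R4 :=
  LinearMap.ker (fderiv ℝ f.value P : R4 →ₗ[ℝ] ℂ)

/-- The curves `{f = 0}` and `{g = 0}` are both mixed non-singular at `P`, and they meet
transversely there. -/
def TransverseAt (f g : MixedPolynomial) (P : R4) : Prop :=
  MixedNonsingularAt f P ∧ MixedNonsingularAt g P ∧ tangentPlane f P ⊔ tangentPlane g P = ⊤

/-- The determinant of the `4 × 4` matrix with columns `w₁, w₂, w₃, w₄`. -/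
def det4 (w₁ w₂ w₃ w₄ : R4) : ℝ :=
  Matrix.det (Matrix.of fun i j => (![w₁, w₂, w₃, w₄] : Fin 4 → R4) j i)

/-- `(v₁, v₂)` is a positive frame of the tangent plane of `{f = 0}` at `P`: followed by the
gradients of the real and imaginary parts of `f` it is a positive frame of `ℝ⁴`. -/
def IsPositiveFrame (f : MixedPolynomial) (P v₁ v₂ : R4) : Prop :=
  v₁ ∈ tangentPlane f P ∧ v₂ ∈ tangentPlane f P ∧ 0 < det4 v₁ v₂ (gradRe f P) (gradIm f P)

/-- A transverse intersection point at which a positive frame of `{f = 0}` followed by a positive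
frame of `{g = 0}` is a positive frame of `ℝ⁴`: the intersection number is `1`. -/
def IsPositiveIntersection (f g : MixedPolynomial) (P : R4) : Prop :=
  TransverseAt f g P ∧ ∃ u₁ u₂ v₁ v₂ : R4,
    IsPositiveFrame f P u₁ u₂ ∧ IsPositiveFrame g P v₁ v₂ ∧ 0 < det4 u₁ u₂ v₁ v₂

/-- A transverse intersection point at which a positive frame of `{f = 0}` followed by a positive
frame of `{g = 0}` is a negative frame of `ℝ⁴`: the intersection number is `-1`. -/
def IsNegativeIntersection (f g : MixedPolynomial) (P : R4) : Prop :=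
  TransverseAt f g P ∧ ∃ u₁ u₂ v₁ v₂ : R4,
    IsPositiveFrame f P u₁ u₂ ∧ IsPositiveFrame g P v₁ v₂ ∧ det4 u₁ u₂ v₁ v₂ < 0

/-! ### The mapping degree of a smooth self-map of the unit sphere `S³` -/

/-- The unit sphere `S³` in `ℝ⁴`. -/
def S3 : Set R4 := Metric.sphere 0 1

/-- The extension `x ↦ ‖x‖ ψ(x / ‖x‖)` of a map `ψ` defined on `S³`. It depends only on `ψ` on
`S³`. If `ψ` is a smooth map from `S³` to `S³` and `x` is in `S³`, its derivative at `x` sends the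
outward normal `x` to the outward normal `ψ x`, and on the orthogonal complement `T_x S³` it is the
differential of `ψ`, with values in `T_{ψ x} S³`. Hence its determinant is that of
`dψ_x : T_x S³ → T_{ψ x} S³` in positive orthonormal bases, `S³` being oriented as the boundary of
the unit ball. -/
def radialExtension (ψ : R4 → R4) (x : R4) : R4 := ‖x‖ • ψ (‖x‖⁻¹ • x)

/-- The determinant of the differential of a smooth map `ψ : S³ → S³` at a point of `S³`. -/
def tangentDet (ψ : R4 → R4) (x : R4) : ℝ := (fderiv ℝ (radialExtension ψ) x).det

/-- The restriction of `ψ` to `S³` is a smooth map from `S³` to `S³`. -/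
def IsSmoothSphereMap (ψ : R4 → R4) : Prop :=
  Set.MapsTo ψ S3 S3 ∧ ContDiffOn ℝ ∞ (radialExtension ψ) {0}ᶜ

/-- The point `y` of `S³` is a regular value of `ψ : S³ → S³`. -/
def IsRegularValue (ψ : R4 → R4) (y : R4) : Prop :=
  y ∈ S3 ∧ ∀ x ∈ S3, ψ x = y → tangentDet ψ x ≠ 0

/-- The smooth map `ψ : S³ → S³` has mapping degree `d`: it has regular values, and the preimages
in `S³` of each of them, counted with the signs of the determinants of the differential of `ψ`,
are finitely many and sum to `d`. -/
def HasMappingDegree (ψ : R4 → R4) (d : ℤ) : Prop :=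
  IsSmoothSphereMap ψ ∧ (∃ y, IsRegularValue ψ y) ∧
    ∀ y, IsRegularValue ψ y →
      {x | x ∈ S3 ∧ ψ x = y}.Finite ∧
        ∑ᶠ x ∈ {x | x ∈ S3 ∧ ψ x = y}, ((SignType.sign (tangentDet ψ x) : SignType) : ℤ) = d

/-! ### The local intersection number -/

/-- The map `(f_R, f_I, g_R, g_I) : ℝ⁴ → ℝ⁴`. -/
def realMap (f g : MixedPolynomial) (x : R4) : R4 :=
  !₂[(f.value x).re, (f.value x).im, (g.value x).re, (g.value x).im]

/-- The normalized map `φ / ‖φ‖` of `φ = (f_R, f_I, g_R, g_I)` on the sphere of radius `ε`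
about `P`, this sphere being parametrized by `u ↦ P + ε u`, `u ∈ S³`. -/
def normalizedMap (f g : MixedPolynomial) (P : R4) (ε : ℝ) (u : R4) : R4 :=
  ‖realMap f g (P + ε • u)‖⁻¹ • realMap f g (P + ε • u)

/-- The radius `ε` is positive and `P` is the only point of `{f = 0} ∩ {g = 0}` in the closed
ball of radius `ε` about `P`. -/
def IsIsolatingRadius (f g : MixedPolynomial) (P : R4) (ε : ℝ) : Prop :=
  0 < ε ∧ curve f ∩ curve g ∩ Metric.closedBall P ε = {P}

/-- `I_top(C, C'; P) = n` for `C = {f = 0}` and `C' = {g = 0}`: `P` is an isolated point of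
`C ∩ C'`, and the normalized map on the sphere of radius `ε` about `P` has mapping degree `n` for
every `ε` such that `P` is the only intersection point in the ball of radius `ε`. -/
def HasLocalIntersectionNumber (f g : MixedPolynomial) (P : R4) (n : ℤ) : Prop :=
  (∃ ε, IsIsolatingRadius f g P ε) ∧
    ∀ ε, IsIsolatingRadius f g P ε → HasMappingDegree (normalizedMap f g P ε) n

/-- `f_t`, `|t| ≤ ρ`, is a continuous family of mixed polynomials: `f_t(z)` is continuous
in `(t, z)`. (This holds when the degrees are bounded and the coefficients are continuous.) -/
def IsContinuousFamily {𝕜 : Type*} [RCLike 𝕜] (ρ : ℝ) (F : 𝕜 → MixedPolynomial) : Prop :=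
  ContinuousOn (fun p : 𝕜 × R4 => (F p.1).value p.2) (Metric.closedBall 0 ρ ×ˢ Set.univ)

end MixedCurve

end

/-! The mapping degree and the count a − b are two evaluations of one integral. Let η be a bump
function of integral one supported in a small ball about 0, and integrate the pull-back of η dy
under φ = (f_R, f_I, g_R, g_I) over a ball (`degreeIntegral`).

The integral is stable. Along a linear homotopy its integrand changes by a divergence, so the
integral is constant while the image of the boundary avoids the support of η
(`degreeIntegral_eq_of_homotopy`). Cutting a homotopy into short pieces reduces families that are
only continuous in the parameter to this case (`eventually_degreeIntegral_eq_of_continuousOn`).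
Removing a region without zeros changes nothing (`eventually_degreeIntegral_eq_of_subset`).

The integral also counts. If all zeros are regular, a change of variables near each one turns it
into the sum of the Jacobian signs (`eventually_degreeIntegral_eq_sum`).

The path (sδ, sδ'), 0 ≤ s ≤ 1, has no zeros on the sphere of radius ε. At s = 1 the Jacobian signs
are the intersection signs (`TransverseAt.det4_mul_det4_pos`), so the integral is a − b. At s = 0
the map is deformed to a smoothed radial extension of φ/‖φ‖, shifted by y/2; its zeros correspond to
the preimages of the regular value y (`IsRegularValue.eventually_degreeIntegral_eq_finsum`). Hence
every regular value has signed count a − b, and Sard's theorem shows that regular values exist.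

Each statement holds once the support radius r of η is small enough. The form `∀ᶠ r in 𝓝[>] 0` lets
one r serve all of them. -/

open MeasureTheory Set Filter Topology Function Module
open scoped RealInnerProductSpace

/-! ### Determinants of vector fields and a divergence identity -/

section

variable {E : Type*} [NormedAddCommGroup E] [NormedSpace ℝ E]
  {ι : Type*} [Fintype ι] [DecidableEq ι]

/-- In a double sum over pairs `i ≠ j` of values of an alternating map, with a fixed vector in
position `i` and a symmetric family in position `j`, the terms cancel in pairs. -/
theorem AlternatingMap.sum_sum_update_update_eq_zero (f : E [⋀^ι]→ₗ[ℝ] ℝ) (v : ι → E) (k : E)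
    (S : ι → ι → E) (hS : ∀ i j, S i j = S j i) :
    ∑ i, ∑ j, (if j = i then 0 else f (update (update v i k) j (S i j))) = 0 := by
  have key : ∀ i j, (if j = i then 0 else f (update (update v i k) j (S i j))) =
      -(if i = j then 0 else f (update (update v j k) i (S j i))) := by
    intro i j
    by_cases hij : j = i
    · simp [hij]
    rw [if_neg hij, if_neg (Ne.symm hij), ← f.map_swap _ hij]
    congr 1
    ext l
    rcases eq_or_ne l i with rfl | hli
    · simp [Function.update_of_ne (Ne.symm hij), Function.update_of_ne hij]
    rcases eq_or_ne l j with rfl | hlj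
    · simp [hS]
    · simp [Equiv.swap_apply_of_ne_of_ne hlj hli, hli, hlj]
  have h2 : ∑ i, ∑ j, (if j = i then 0 else f (update (update v i k) j (S i j))) =
      -∑ i, ∑ j, (if j = i then 0 else f (update (update v i k) j (S i j))) := by
    conv_lhs => rw [Finset.sum_comm]
    simp only [← Finset.sum_neg_distrib]
    exact Finset.sum_congr rfl fun i _ => Finset.sum_congr rfl fun j _ => key j i
  linarith

/-- Cramer's rule in terms of the determinant in a basis. -/
theorem Module.Basis.sum_det_update_smul (b : Basis ι ℝ E) (v : ι → E) (k : E) :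
    ∑ i, b.det (update v i k) • v i = b.det v • k := by
  apply b.repr.injective
  ext l
  have h := congrFun (Matrix.mulVec_cramer (b.toMatrix v) (b.repr k)) l
  simp only [Matrix.mulVec, dotProduct, Matrix.cramer_apply, ← Basis.toMatrix_update] at h
  simp only [map_sum, map_smul, Finsupp.coe_finsetSum, Finset.sum_apply, Finsupp.smul_apply,
    smul_eq_mul, Basis.det_apply]
  simp only [Pi.smul_apply, smul_eq_mul] at h
  rw [← h]
  exact Finset.sum_congr rfl fun i _ => by rw [Basis.toMatrix_apply, mul_comm]

/-- The determinant in a basis as a continuous multilinear map. -/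
noncomputable def Module.Basis.continuousDet [FiniteDimensional ℝ E] (b : Basis ι ℝ E) :
    ContinuousMultilinearMap ℝ (fun _ : ι => E) ℝ where
  toMultilinearMap := b.det.toMultilinearMap
  cont := by
    change Continuous fun v : ι → E => b.det v
    simp only [Basis.det_apply]
    refine Continuous.matrix_det (continuous_matrix fun i j => ?_)
    exact (b.coord i).continuous_of_finiteDimensional.comp (continuous_apply j)

theorem Module.Basis.continuousDet_apply [FiniteDimensional ℝ E] (b : Basis ι ℝ E) (v : ι → E) :
    b.continuousDet v = b.det v := rfl

theorem HasFDerivAt.basis_det [FiniteDimensional ℝ E] {F : Type*} [NormedAddCommGroup F]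
    [NormedSpace ℝ F] (b : Basis ι ℝ E) {w : F → ι → E} {w' : F →L[ℝ] ι → E} {x : F}
    (hw : HasFDerivAt w w' x) :
    HasFDerivAt (fun x => b.det (w x)) ((b.continuousDet.linearDeriv (w x)).comp w') x :=
  (b.continuousDet.hasFDerivAt (w x)).comp x hw

theorem ContDiff.basis_det [FiniteDimensional ℝ E] {F : Type*} [NormedAddCommGroup F]
    [NormedSpace ℝ F] (b : Basis ι ℝ E) {w : F → ι → E} {n : WithTop ℕ∞} (hw : ContDiff ℝ n w) :
    ContDiff ℝ n (fun x => b.det (w x)) :=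
  b.continuousDet.contDiff.comp hw

theorem Continuous.basis_det [FiniteDimensional ℝ E] {X : Type*} [TopologicalSpace X]
    (b : Basis ι ℝ E) {w : X → ι → E} (hw : Continuous w) : Continuous (fun x => b.det (w x)) :=
  b.continuousDet.cont.comp hw

theorem ContinuousLinearMap.det_eq_basis_det (b : Basis ι ℝ E) (A : E →L[ℝ] E) :
    A.det = b.det fun i => A (b i) := by
  have := b.det_comp (A : E →ₗ[ℝ] E) b
  rw [b.det_self, mul_one] at this
  exact this.symm

/-- The divergence of the vector field with components `η(φ) det(∂₁φ, …, k, …, ∂ₙφ)`, with `k` in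
position `i`. The second derivatives of `φ` cancel. -/
theorem sum_fderiv_mul_det_update [FiniteDimensional ℝ E] (b : Basis ι ℝ E) {φ k : E → E}
    {η : E → ℝ} (hφ : ContDiff ℝ 2 φ) (hk : ContDiff ℝ 1 k) (hη : ContDiff ℝ 1 η) (x : E) :
    ∑ i, fderiv ℝ (fun y => η (φ y) *
        b.det (update (fun j => fderiv ℝ φ y (b j)) i (k y))) x (b i) =
      fderiv ℝ η (φ x) (k x) * (fderiv ℝ φ x).det +
        η (φ x) * ∑ i, b.det (update (fun j => fderiv ℝ φ x (b j)) i (fderiv ℝ k x (b i))) := by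
  have hφ1 : ContDiff ℝ 1 (fderiv ℝ φ) := hφ.fderiv_right (by norm_num)
  have hφ' : HasFDerivAt φ (fderiv ℝ φ x) x :=
    (hφ.differentiable (by norm_num)).differentiableAt.hasFDerivAt
  have hφ'' : HasFDerivAt (fderiv ℝ φ) (fderiv ℝ (fderiv ℝ φ) x) x :=
    (hφ1.differentiable (by norm_num)).differentiableAt.hasFDerivAt
  have hk' : HasFDerivAt k (fderiv ℝ k x) x :=
    (hk.differentiable (by norm_num)).differentiableAt.hasFDerivAt
  have hη' : HasFDerivAt η (fderiv ℝ η (φ x)) (φ x) :=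
    (hη.differentiable (by norm_num)).differentiableAt.hasFDerivAt
  set v : ι → E := fun j => fderiv ℝ φ x (b j) with hv
  set S : ι → ι → E := fun i j => fderiv ℝ (fderiv ℝ φ) x (b i) (b j) with hS
  have hsymm : ∀ i j, S i j = S j i := fun i j =>
    (hφ.contDiffAt.isSymmSndFDerivAt (by simp)) (b i) (b j)
  have hterm : ∀ i, fderiv ℝ (fun y => η (φ y) *
        b.det (update (fun j => fderiv ℝ φ y (b j)) i (k y))) x (b i) =
      b.det (update v i (k x)) * fderiv ℝ η (φ x) (v i) +
      η (φ x) * (b.det (update v i (fderiv ℝ k x (b i))) +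
        ∑ j, (if j = i then 0 else b.det (update (update v i (k x)) j (S i j)))) := by
    intro i
    have hw : HasFDerivAt (fun y => update (fun j => fderiv ℝ φ y (b j)) i (k y))
        (ContinuousLinearMap.pi fun j => if j = i then fderiv ℝ k x else
          (ContinuousLinearMap.apply ℝ E (b j)).comp (fderiv ℝ (fderiv ℝ φ) x)) x := by
      rw [hasFDerivAt_pi']
      intro j
      rcases eq_or_ne j i with rfl | hji
      · simpa [ContinuousLinearMap.proj_pi] using hk'
      · have h := (ContinuousLinearMap.apply ℝ E (b j)).hasFDerivAt.comp x hφ''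
        simp only [Function.comp_def] at h
        simpa [ContinuousLinearMap.proj_pi, hji] using h
    have hmul := (hη'.comp x hφ').mul (hw.basis_det b)
    rw [show (fun y => η (φ y) * b.det (update (fun j => fderiv ℝ φ y (b j)) i (k y))) =
      (η ∘ φ) * fun y => b.det (update (fun j => fderiv ℝ φ y (b j)) i (k y)) from rfl, hmul.fderiv]
    simp only [_root_.add_apply, _root_.smul_apply,
      ContinuousLinearMap.comp_apply, ContinuousMultilinearMap.linearDeriv_apply, smul_eq_mul,
      Basis.continuousDet_apply, Function.comp]
    rw [add_comm]
    congr 2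
    rw [← Finset.add_sum_erase _ _ (Finset.mem_univ i)]
    rw [← Finset.add_sum_erase _ _ (Finset.mem_univ i)]
    simp only [if_true, zero_add, ContinuousLinearMap.pi_apply, update_idem]
    congr 1
    refine Finset.sum_congr rfl fun j hj => ?_
    have hji : j ≠ i := Finset.ne_of_mem_erase hj
    simp [hji, hS, hv]
  simp only [hterm]
  rw [Finset.sum_add_distrib, ← Finset.mul_sum, Finset.sum_add_distrib,
    AlternatingMap.sum_sum_update_update_eq_zero b.det v (k x) S hsymm, add_zero]
  congr 1
  -- The terms that differentiate η combine by Cramer's rule, to which the linear form dη is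
  -- applied.
  have := congrArg (fderiv ℝ η (φ x)) (b.sum_det_update_smul v (k x))
  simp only [map_sum, map_smul, smul_eq_mul] at this
  rw [this, ContinuousLinearMap.det_eq_basis_det b, mul_comm]

/-- With p = φ(x), A = Dφ(x) and K = Dk(x), this derivative has the same form as the divergence in
`sum_fderiv_mul_det_update`, taken for the map φ + tk. So the integrand of the degree integral
varies by a divergence. -/
theorem hasDerivAt_mul_det [FiniteDimensional ℝ E] (b : Basis ι ℝ E) (p k : E)
    (A K : E →L[ℝ] E) {η : E → ℝ} (hη : ContDiff ℝ 1 η) (t : ℝ) :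
    HasDerivAt (fun t : ℝ => η (p + t • k) * (A + t • K).det)
      (fderiv ℝ η (p + t • k) k * (A + t • K).det + η (p + t • k) *
        ∑ i, b.det (update (fun j => (A + t • K) (b j)) i (K (b i)))) t := by
  have hη' : HasFDerivAt η (fderiv ℝ η (p + t • k)) (p + t • k) :=
    (hη.differentiable (by norm_num)).differentiableAt.hasFDerivAt
  have h1 : HasDerivAt (fun t : ℝ => p + t • k) k t := by
    simpa using ((hasDerivAt_id t).smul_const k).const_add p
  have h2 : HasDerivAt (fun t : ℝ => fun j => (A + t • K) (b j)) (fun j => K (b j)) t := by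
    rw [hasDerivAt_pi]
    intro j
    simpa using ((hasDerivAt_id t).smul_const (K (b j))).const_add (A (b j))
  have h3 := ((b.continuousDet.hasFDerivAt (fun j => (A + t • K) (b j))).comp_hasDerivAt t h2)
  have h4 := (hη'.comp_hasDerivAt t h1).mul h3
  rw [ContinuousMultilinearMap.linearDeriv_apply] at h4
  simp only [Basis.continuousDet_apply, Function.comp_def] at h4
  simp only [ContinuousLinearMap.det_eq_basis_det b]
  exact h4

end

/-! ### The degree integral and its invariance under linear homotopies -/

section

variable {E : Type*} [NormedAddCommGroup E] [NormedSpace ℝ E]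

/-- Extension by zero creates no jump because V already vanishes near each boundary point. No
regularity of the boundary is needed, and integration by parts on the whole space becomes available.
-/
theorem HasFDerivAt.indicator_of_frontier {V : E → ℝ} (hV : Differentiable ℝ V) {U : Set E}
    (hU : IsOpen U) (hV0 : ∀ x ∈ frontier U, V =ᶠ[𝓝 x] 0) (x : E) :
    HasFDerivAt (U.indicator V) (U.indicator (fderiv ℝ V) x) x := by
  by_cases hxU : x ∈ U
  · rw [indicator_of_mem hxU]
    refine (hV x).hasFDerivAt.congr_of_eventuallyEq ?_
    filter_upwards [hU.mem_nhds hxU] with y hy using indicator_of_mem hy V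
  · rw [indicator_of_notMem hxU]
    refine (hasFDerivAt_const (0 : ℝ) x).congr_of_eventuallyEq ?_
    by_cases hxc : x ∈ closure U
    · filter_upwards [hV0 x ⟨hxc, by rwa [hU.interior_eq]⟩] with y hy
      by_cases hyU : y ∈ U <;> simp_all
    · filter_upwards [isClosed_closure.isOpen_compl.mem_nhds hxc] with y hy
      exact indicator_of_notMem (fun h => hy (subset_closure h)) V

variable [FiniteDimensional ℝ E] [MeasurableSpace E] [BorelSpace E]

theorem Continuous.integrableOn_of_isBounded {μ : Measure E} [IsFiniteMeasureOnCompacts μ]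
    {F : Type*} [NormedAddCommGroup F] {V : E → F}
    (hV : Continuous V) {U : Set E} (hb : Bornology.IsBounded U) : IntegrableOn V U μ :=
  (hV.continuousOn.integrableOn_compact hb.isCompact_closure).mono_set subset_closure

variable (μ : Measure E) [μ.IsAddHaarMeasure]

/-- A directional derivative of a function which vanishes near the boundary of a bounded open set
has integral zero over this set. -/
theorem setIntegral_fderiv_apply_eq_zero {V : E → ℝ} (hV : ContDiff ℝ 1 V) {U : Set E}
    (hU : IsOpen U) (hb : Bornology.IsBounded U) (hV0 : ∀ x ∈ frontier U, V =ᶠ[𝓝 x] 0) (v : E) :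
    ∫ x in U, fderiv ℝ V x v ∂μ = 0 := by
  have hd : Continuous fun x => fderiv ℝ V x v :=
    (hV.continuous_fderiv (by norm_num)).clm_apply continuous_const
  have hi := (hd.integrableOn_of_isBounded (μ := μ) hb).integrable_indicator hU.measurableSet
  have hi' := (hV.continuous.integrableOn_of_isBounded (μ := μ) hb).integrable_indicator
    hU.measurableSet
  have hline : ∀ x, HasLineDerivAt ℝ (U.indicator V) (U.indicator (fun x => fderiv ℝ V x v) x) x v := by
    intro x
    have h := (HasFDerivAt.indicator_of_frontier (hV.differentiable (by norm_num)) hU hV0 x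
      ).hasLineDerivAt v
    convert h using 1
    by_cases hx : x ∈ U <;> simp [hx]
  -- Integration by parts against the constant 1, whose derivative is zero.
  have key := integral_bilinear_hasLineDerivAt_right_eq_neg_left_of_integrable (μ := μ) (v := v)
    (f := fun _ => (1 : ℝ)) (f' := fun _ => (0 : ℝ)) (B := ContinuousLinearMap.mul ℝ ℝ)
    (g := U.indicator V) (g' := U.indicator fun x => fderiv ℝ V x v)
    (by simp) (by simpa using hi) (by simpa using hi')
    (fun x _ => (hasFDerivAt_const (1 : ℝ) x).hasLineDerivAt v) (fun x _ => hline x)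
  simpa [integral_indicator hU.measurableSet] using key

/-- The integral of the pull-back under `φ` of the top-degree form `η dy` over `U`. If `η` is
concentrated near `0` and has integral one, this is the degree of `φ` over `0`. -/
noncomputable def degreeIntegral (η : E → ℝ) (φ : E → E) (U : Set E) : ℝ :=
  ∫ x in U, η (φ x) * (fderiv ℝ φ x).det ∂μ

/-- The degree integral is invariant under linear homotopies which avoid the support of `η` on the
boundary. -/
theorem degreeIntegral_eq_of_homotopy {η : E → ℝ} (hη : ContDiff ℝ 1 η) {φ ψ : E → E}
    (hφ : ContDiff ℝ 2 φ) (hψ : ContDiff ℝ 2 ψ) {U : Set E} (hU : IsOpen U)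
    (hb : Bornology.IsBounded U)
    (h0 : ∀ x ∈ frontier U, ∀ t ∈ Icc (0 : ℝ) 1, φ x + t • (ψ x - φ x) ∉ tsupport η) :
    degreeIntegral μ η φ U = degreeIntegral μ η ψ U := by
  set b := Module.finBasis ℝ E
  set k : E → E := fun x => ψ x - φ x with hkdef
  have hk : ContDiff ℝ 2 k := hψ.sub hφ
  have hφd : Continuous (fderiv ℝ φ) := hφ.continuous_fderiv (by norm_num)
  have hkd : Continuous (fderiv ℝ k) := hk.continuous_fderiv (by norm_num)
  have hηd : Continuous (fderiv ℝ η) := hη.continuous_fderiv (by norm_num)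
  let I : ℝ → E → ℝ := fun t x => η (φ x + t • k x) * (fderiv ℝ φ x + t • fderiv ℝ k x).det
  let J : ℝ → E → ℝ := fun t x => fderiv ℝ η (φ x + t • k x) (k x) *
      (fderiv ℝ φ x + t • fderiv ℝ k x).det + η (φ x + t • k x) *
        ∑ i, b.det (update (fun j => (fderiv ℝ φ x + t • fderiv ℝ k x) (b j)) i
          (fderiv ℝ k x (b i)))
  have hIJ : ∀ x t, HasDerivAt (fun t => I t x) (J t x) t := fun x t =>
    hasDerivAt_mul_det b (φ x) (k x) (fderiv ℝ φ x) (fderiv ℝ k x) hη t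
  have hlin : Continuous fun p : ℝ × E => φ p.2 + p.1 • k p.2 := by
    have := hφ.continuous; have := hk.continuous; fun_prop
  have hlind : Continuous fun p : ℝ × E => fderiv ℝ φ p.2 + p.1 • fderiv ℝ k p.2 := by fun_prop
  have hJc : Continuous (uncurry J) := by
    have hdet : Continuous fun p : ℝ × E => (fderiv ℝ φ p.2 + p.1 • fderiv ℝ k p.2).det :=
      ContinuousLinearMap.continuous_det.comp hlind
    have h1 : Continuous fun p : ℝ × E => fderiv ℝ η (φ p.2 + p.1 • k p.2) (k p.2) :=
      (hηd.comp hlin).clm_apply (hk.continuous.comp continuous_snd)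
    refine (h1.mul hdet).add ((hη.continuous.comp hlin).mul
      (continuous_finsetSum _ fun i _ => Continuous.basis_det b ?_))
    refine Continuous.update (continuous_pi fun j => hlind.clm_apply continuous_const) i ?_
    exact (hkd.comp continuous_snd).clm_apply continuous_const
  have hI0 : degreeIntegral μ η φ U = ∫ x in U, I 0 x ∂μ := by simp [degreeIntegral, I]
  have hI1 : degreeIntegral μ η ψ U = ∫ x in U, I 1 x ∂μ := by
    have : ∀ x, fderiv ℝ φ x + fderiv ℝ k x = fderiv ℝ ψ x := by
      intro x
      rw [hkdef, fderiv_fun_sub (hψ.differentiable (by norm_num) x)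
        (hφ.differentiable (by norm_num) x)]
      abel
    have hk1 : ∀ x, φ x + k x = ψ x := fun x => by simp [hkdef]
    simp [degreeIntegral, I, this, hk1]
  have hIc : ∀ t, Continuous (I t) := fun t =>
    (hη.continuous.comp (hlin.comp (Continuous.prodMk_right t))).mul
      (ContinuousLinearMap.continuous_det.comp (hlind.comp (Continuous.prodMk_right t)))
  have hJ0 : ∀ t ∈ Icc (0 : ℝ) 1, ∫ x in U, J t x ∂μ = 0 := by
    intro t ht
    have hH : ContDiff ℝ 2 fun x => φ x + t • k x := hφ.add (hk.const_smul t)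
    have hHd : ∀ x, fderiv ℝ (fun x => φ x + t • k x) x = fderiv ℝ φ x + t • fderiv ℝ k x := by
      intro x
      rw [fderiv_fun_add (hφ.differentiable (by norm_num) x)
        ((hk.const_smul t).differentiable (by norm_num) x),
        fderiv_fun_const_smul (hk.differentiable (by norm_num) x)]
    have hdiv := fun x => sum_fderiv_mul_det_update b hH (hk.of_le (by norm_num)) hη x
    simp only [hHd] at hdiv
    -- The t-derivative J of the integrand is recognised as a divergence. The components of the
    -- field contain the factor η(φ + tk), which vanishes near the boundary.
    change ∀ x, _ = J t x at hdiv
    simp only [← hdiv]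
    have hVc : ∀ i, ContDiff ℝ 1 fun y => η (φ y + t • k y) *
        b.det (update (fun j => (fderiv ℝ φ y + t • fderiv ℝ k y) (b j)) i (k y)) := by
      intro i
      refine (hη.comp (hH.of_le (by norm_num))).mul (ContDiff.basis_det b ?_)
      rw [contDiff_pi]
      intro j
      rcases eq_or_ne j i with rfl | hji
      · simpa using hk.of_le (by norm_num)
      · simp only [update_of_ne hji]
        exact (((hφ.fderiv_right (m := 1) (by norm_num))).add
          ((hk.fderiv_right (m := 1) (by norm_num)).const_smul t)).clm_apply contDiff_const
    rw [integral_finsetSum]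
    · refine Finset.sum_eq_zero fun i _ => setIntegral_fderiv_apply_eq_zero μ (hVc i) hU hb ?_ _
      intro x hx
      have h1 : η =ᶠ[𝓝 (φ x + t • k x)] 0 := notMem_tsupport_iff_eventuallyEq.1 (h0 x hx t ht)
      filter_upwards [hH.continuous.continuousAt.eventually h1] with y hy
      simp only [hy, Pi.zero_apply, zero_mul]
    · intro i _
      exact (((hVc i).continuous_fderiv (by norm_num)).clm_apply
        continuous_const).integrableOn_of_isBounded hb
  have hint : Integrable (uncurry J) ((volume.restrict (uIoc 0 1)).prod (μ.restrict U)) := by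
    rw [Measure.prod_restrict]
    refine (hJc.continuousOn.integrableOn_compact
      ((isCompact_Icc (a := (0 : ℝ)) (b := 1)).prod hb.isCompact_closure)).mono_set
      (prod_mono ?_ subset_closure)
    rw [uIoc_of_le zero_le_one]
    exact Ioc_subset_Icc_self
  -- By Fubini and the fundamental theorem of calculus, the difference of the two degree integrals
  -- is the t-integral of the vanishing integrals of J.
  have hswap := intervalIntegral_integral_swap hint
  have hftc : ∀ x, ∫ t in (0 : ℝ)..1, J t x = I 1 x - I 0 x := fun x =>
    intervalIntegral.integral_eq_sub_of_hasDerivAt (fun t _ => hIJ x t)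
      (hJc.comp (Continuous.prodMk_left x)).continuousOn.intervalIntegrable
  simp only [hftc] at hswap
  rw [integral_sub ((hIc 1).integrableOn_of_isBounded hb) ((hIc 0).integrableOn_of_isBounded hb),
    ← hI0, ← hI1, intervalIntegral.integral_congr (g := fun _ => 0)
      (fun t ht => hJ0 t (by simpa [uIcc_of_le zero_le_one] using ht))] at hswap
  simp only [intervalIntegral.integral_const, smul_zero] at hswap
  linarith

end

/-! ### Counting regular zeros with signs -/

section

theorem IsCompact.eventually_lt_norm {X F : Type*} [TopologicalSpace X] [NormedAddCommGroup F]
    {K : Set X} (hK : IsCompact K) {φ : X → F} (hφ : ContinuousOn φ K) (h0 : ∀ x ∈ K, φ x ≠ 0) :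
    ∀ᶠ r in 𝓝[>] (0 : ℝ), ∀ x ∈ K, r < ‖φ x‖ := by
  obtain ⟨c, hc, h⟩ := hK.exists_forall_le' hφ.norm (a := 0) fun x hx => norm_pos_iff.2 (h0 x hx)
  filter_upwards [Ioo_mem_nhdsGT hc] with r hr x hx using hr.2.trans_le (h x hx)

variable {E : Type*} [NormedAddCommGroup E] [NormedSpace ℝ E] [FiniteDimensional ℝ E]

/-- The inverse function theorem, together with continuity of the Jacobian: shrinking the
neighbourhood keeps the sign constant. This prepares the change of variables around a regular zero.
-/
theorem ContDiff.exists_isOpen_injOn_sign_det {φ : E → E} (hφ : ContDiff ℝ 1 φ) {z : E}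
    (hz : (fderiv ℝ φ z).det ≠ 0) {N : Set E} (hN : N ∈ 𝓝 z) :
    ∃ W ⊆ N, IsOpen W ∧ z ∈ W ∧ InjOn φ W ∧ φ '' W ∈ 𝓝 (φ z) ∧
      ∀ x ∈ W, SignType.sign (fderiv ℝ φ x).det = SignType.sign (fderiv ℝ φ z).det := by
  let L := (fderiv ℝ φ z).toContinuousLinearEquivOfDetNeZero hz
  have hs : HasStrictFDerivAt φ (L : E →L[ℝ] E) z :=
    hφ.contDiffAt.hasStrictFDerivAt (by norm_num)
  have hdc : Continuous fun x => (fderiv ℝ φ x).det :=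
    ContinuousLinearMap.continuous_det.comp (hφ.continuous_fderiv (by norm_num))
  have hsign : ∀ᶠ x in 𝓝 z,
      SignType.sign (fderiv ℝ φ x).det = SignType.sign (fderiv ℝ φ z).det := by
    rcases hz.lt_or_gt with h | h
    · filter_upwards [hdc.continuousAt.eventually (gt_mem_nhds h)] with x hx
      rw [sign_neg h, sign_neg hx]
    · filter_upwards [hdc.continuousAt.eventually (lt_mem_nhds h)] with x hx
      rw [sign_pos h, sign_pos hx]
  set e := hs.toOpenPartialHomeomorph φ with he
  have hsrc : e.source ∈ 𝓝 z := e.open_source.mem_nhds hs.mem_toOpenPartialHomeomorph_source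
  obtain ⟨W, hW, hWo, hzW⟩ := mem_nhds_iff.1 (inter_mem (inter_mem hN hsrc) hsign)
  refine ⟨W, fun x hx => (hW hx).1.1, hWo, hzW, ?_, ?_, fun x hx => (hW hx).2⟩
  · exact e.injOn.mono fun x hx => (hW hx).1.2
  · rw [← hs.map_nhds_eq_of_equiv]
    exact image_mem_map (hWo.mem_nhds hzW)

/-- A `C¹` map has finitely many zeros with invertible derivative in a compact set. -/
theorem ContDiff.finite_zeros_of_det_ne_zero {φ : E → E} (hφ : ContDiff ℝ 1 φ) {K : Set E}
    (hK : IsCompact K) (hdet : ∀ x ∈ K, φ x = 0 → (fderiv ℝ φ x).det ≠ 0) :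
    {x ∈ K | φ x = 0}.Finite := by
  have hc : IsCompact {x ∈ K | φ x = 0} :=
    hK.inter_right (isClosed_singleton.preimage hφ.continuous)
  refine hc.finite (isDiscrete_iff_nhdsNE.2 fun x hx => ?_)
  obtain ⟨W, -, hWo, hxW, hinj, -, -⟩ :=
    hφ.exists_isOpen_injOn_sign_det (hdet x hx.1 hx.2) univ_mem
  rw [← disjoint_iff, disjoint_comm, disjoint_principal_left]
  rw [mem_nhdsWithin]
  refine ⟨W, hWo, hxW, fun y hy hy' => hy.2 ?_⟩
  exact hinj hy.1 hxW (by rw [hy'.2, hx.2])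

variable [MeasurableSpace E] (μ : Measure E)

/-- Excision: by compactness φ is bounded away from 0 on the part removed, so the integrand vanishes
there as soon as r is below that bound. -/
theorem eventually_degreeIntegral_eq_of_subset {φ : E → E} (hφ : Continuous φ) {U U' : Set E}
    (hU : IsOpen U) (hU' : MeasurableSet U') (hb : Bornology.IsBounded U') (hUU' : U ⊆ U')
    (h0 : ∀ x ∈ closure U', x ∉ U → φ x ≠ 0) :
    ∀ᶠ r in 𝓝[>] (0 : ℝ), ∀ η : E → ℝ, support η ⊆ Metric.ball 0 r →
      degreeIntegral μ η φ U = degreeIntegral μ η φ U' := by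
  have hK : IsCompact (closure U' \ U) := hb.isCompact_closure.diff hU
  filter_upwards [hK.eventually_lt_norm hφ.continuousOn fun x hx => h0 x hx.1 hx.2] with r hr η hη
  refine (setIntegral_eq_of_subset_of_forall_sdiff_eq_zero hU' hUU' fun x hx => ?_).symm
  have : η (φ x) = 0 := by
    by_contra h
    have := hη h
    rw [mem_ball_zero_iff] at this
    exact lt_asymm this (hr x ⟨subset_closure hx.1, hx.2⟩)
  rw [this, zero_mul]

variable [BorelSpace E] [μ.IsAddHaarMeasure]

/-- If all zeros of `φ` are regular, the degree integral counts them with signs. -/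
theorem eventually_degreeIntegral_eq_sum {φ : E → E} (hφ : ContDiff ℝ 1 φ) {U : Set E}
    (hU : IsOpen U) (hb : Bornology.IsBounded U) {Z : Finset E}
    (hZ : ∀ x ∈ closure U, φ x = 0 → x ∈ Z) (hZU : ∀ z ∈ Z, z ∈ U) (hZ0 : ∀ z ∈ Z, φ z = 0)
    (hdet : ∀ z ∈ Z, (fderiv ℝ φ z).det ≠ 0) :
    ∀ᶠ r in 𝓝[>] (0 : ℝ), ∀ η : E → ℝ, Continuous η → support η ⊆ Metric.ball 0 r →
      ∫ x, η x ∂μ = 1 →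
      degreeIntegral μ η φ U = ∑ z ∈ Z, ((SignType.sign (fderiv ℝ φ z).det : SignType) : ℝ) := by
  obtain ⟨N, hN, hNd⟩ := Z.finite_toSet.t2_separation
  have hW : ∀ z ∈ Z, ∃ W ⊆ N z ∩ U, IsOpen W ∧ z ∈ W ∧ InjOn φ W ∧ φ '' W ∈ 𝓝 (φ z) ∧
      ∀ x ∈ W, SignType.sign (fderiv ℝ φ x).det = SignType.sign (fderiv ℝ φ z).det := fun z hz =>
    hφ.exists_isOpen_injOn_sign_det (hdet z hz)
      (inter_mem ((hN z).2.mem_nhds (hN z).1) (hU.mem_nhds (hZU z hz)))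
  choose! W hWN hWo hzW hinj himg hsign using hW
  have hWU : (⋃ z ∈ Z, W z) ⊆ U := iUnion₂_subset fun z hz => (hWN z hz).trans inter_subset_right
  have hWuo : IsOpen (⋃ z ∈ Z, W z) := isOpen_biUnion hWo
  have hball : ∀ᶠ r in 𝓝[>] (0 : ℝ), ∀ z ∈ Z, Metric.ball 0 r ⊆ φ '' W z := by
    rw [Filter.eventually_all_finset]
    intro z hz
    have h := himg z hz
    rw [hZ0 z hz] at h
    obtain ⟨d, hd, hsub⟩ := Metric.mem_nhds_iff.1 h
    filter_upwards [Ioo_mem_nhdsGT hd] with r hr using (Metric.ball_subset_ball hr.2.le).trans hsub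
  filter_upwards [hball, eventually_degreeIntegral_eq_of_subset μ hφ.continuous hWuo
    hU.measurableSet hb hWU fun x hx hxW h => hxW (mem_biUnion (hZ x hx h) (hzW x (hZ x hx h)))]
    with r hr hsub η hηc hη hη1
  rw [← hsub η hη, degreeIntegral, integral_biUnion_finset]
  · refine Finset.sum_congr rfl fun z hz => ?_
    -- Splitting the Jacobian into sign and absolute value leaves the integral of η over the image
    -- of W z. This image contains the support of η, so the integral is 1.
    have h1 : ∀ x ∈ W z, η (φ x) * (fderiv ℝ φ x).det =
        ((SignType.sign (fderiv ℝ φ z).det : SignType) : ℝ) *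
          (|(fderiv ℝ φ x).det| • η (φ x)) := by
      intro x hx
      rw [← hsign z hz x hx, smul_eq_mul, ← mul_assoc, sign_mul_abs, mul_comm]
    rw [setIntegral_congr_fun (hWo z hz).measurableSet h1, integral_const_mul,
      ← integral_image_eq_integral_abs_det_fderiv_smul μ (hWo z hz).measurableSet
        (fun x _ => (hφ.differentiable (by norm_num) x).hasFDerivAt.hasFDerivWithinAt)
        (hinj z hz),
      setIntegral_eq_integral_of_forall_compl_eq_zero, hη1, mul_one]
    intro x hx
    by_contra h
    exact hx (hr z hz (hη h))
  · exact fun z hz => (hWo z hz).measurableSet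
  · exact fun i hi j hj hij => (hNd hi hj hij).mono ((hWN i hi).trans inter_subset_left)
      ((hWN j hj).trans inter_subset_left)
  · intro z hz
    refine Continuous.integrableOn_of_isBounded ?_
      (hb.subset ((hWN z hz).trans inter_subset_right))
    exact (hηc.comp hφ.continuous).mul
      (ContinuousLinearMap.continuous_det.comp (hφ.continuous_fderiv (by norm_num)))

/-- There are smooth functions with integral one concentrated near `0`. -/
theorem exists_contDiff_integral_eq_one {r : ℝ} (hr : 0 < r) :
    ∃ η : E → ℝ, ContDiff ℝ 1 η ∧ tsupport η ⊆ Metric.ball 0 r ∧ ∫ x, η x ∂μ = 1 := by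
  let β : ContDiffBump (0 : E) := ⟨r / 4, r / 2, by positivity, by linarith⟩
  refine ⟨β.normed μ, β.contDiff_normed, ?_, β.integral_normed⟩
  rw [β.tsupport_normed_eq]
  exact Metric.closedBall_subset_ball (by change r / 2 < r; linarith)

end

/-! ### Homotopies that are only continuous in the parameter -/

section

variable {E : Type*} [NormedAddCommGroup E] [NormedSpace ℝ E] [FiniteDimensional ℝ E]
  [MeasurableSpace E] [BorelSpace E] (μ : Measure E) [μ.IsAddHaarMeasure]

/-- The degree integral is invariant under continuous homotopies through `C²` maps without zeros on
the boundary. -/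
theorem eventually_degreeIntegral_eq_of_continuousOn {Φ : unitInterval → E → E}
    (hΦ : ∀ s, ContDiff ℝ 2 (Φ s)) {U : Set E} (hU : IsOpen U) (hb : Bornology.IsBounded U)
    (hc : ContinuousOn (uncurry Φ) (univ ×ˢ frontier U))
    (h0 : ∀ s, ∀ x ∈ frontier U, Φ s x ≠ 0) :
    ∀ᶠ r in 𝓝[>] (0 : ℝ), ∀ η : E → ℝ, ContDiff ℝ 1 η → tsupport η ⊆ Metric.ball 0 r →
      degreeIntegral μ η (Φ 0) U = degreeIntegral μ η (Φ 1) U := by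
  have hK : IsCompact (frontier U) :=
    hb.isCompact_closure.of_isClosed_subset isClosed_frontier frontier_subset_closure
  have : CompactSpace (frontier U) := isCompact_iff_compactSpace.1 hK
  let f : C(unitInterval × frontier U, E) :=
    ⟨fun p => Φ p.1 p.2, hc.comp_continuous
      (f := fun p : unitInterval × frontier U => (p.1, (p.2 : E))) (by fun_prop) fun p => ⟨mem_univ _, p.2.2⟩⟩
  -- The factor 1/2 gives ‖Φ‖ > 2r on the boundary. A linear homotopy to a map within distance r
  -- there keeps norm greater than r, hence misses the support of η.
  have hhalf := (isCompact_univ.prod hK).eventually_lt_norm (φ := fun p => (1 / 2 : ℝ) • uncurry Φ p)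
    (hc.const_smul _) fun p hp => smul_ne_zero (by norm_num) (h0 p.1 p.2 hp.2)
  filter_upwards [hhalf, self_mem_nhdsWithin] with r hr hr0 η hη hηr
  have hloc : IsLocallyConstant fun s => degreeIntegral μ η (Φ s) U := by
    rw [IsLocallyConstant.iff_eventually_eq]
    intro s₀
    -- Currying into the space of continuous maps on the compact boundary turns joint continuity
    -- into uniform closeness.
    have hd : ∀ᶠ s in 𝓝 s₀, dist (f.curry s) (f.curry s₀) < r :=
      f.curry.continuous.continuousAt.eventually (Metric.ball_mem_nhds _ hr0)
    filter_upwards [hd] with s hs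
    refine (degreeIntegral_eq_of_homotopy μ hη (hΦ s₀) (hΦ s) hU hb fun x hx t ht hmem => ?_).symm
    have h1 : ‖Φ s x - Φ s₀ x‖ < r := by
      rw [← dist_eq_norm]
      exact (ContinuousMap.dist_apply_le_dist (f := f.curry s) (g := f.curry s₀) ⟨x, hx⟩).trans_lt hs
    have h2 := mem_ball_zero_iff.1 (hηr hmem)
    have h3 := hr (s₀, x) ⟨mem_univ _, hx⟩
    rw [norm_smul] at h3
    norm_num at h3
    have h4 : ‖t • (Φ s x - Φ s₀ x)‖ ≤ ‖Φ s x - Φ s₀ x‖ := by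
      rw [norm_smul, Real.norm_of_nonneg ht.1]
      exact mul_le_of_le_one_left (norm_nonneg _) ht.2
    have h5 := norm_sub_le (Φ s₀ x + t • (Φ s x - Φ s₀ x)) (t • (Φ s x - Φ s₀ x))
    rw [add_sub_cancel_right] at h5
    linarith
  exact hloc.apply_eq_of_isPreconnected isPreconnected_univ (mem_univ _) (mem_univ _)

end

/-! ### Radial extensions and the degree of a map of spheres -/

namespace MixedCurve

theorem radialExtension_smul (ψ : R4 → R4) {c : ℝ} (hc : 0 < c) (x : R4) :
    radialExtension ψ (c • x) = c • radialExtension ψ x := by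
  unfold radialExtension
  rw [norm_smul, Real.norm_of_nonneg hc.le, smul_smul c, smul_smul (c * ‖x‖)⁻¹,
    show (c * ‖x‖)⁻¹ * c = ‖x‖⁻¹ by field_simp]

theorem radialExtension_of_mem {ψ : R4 → R4} {x : R4} (hx : x ∈ S3) :
    radialExtension ψ x = ψ x := by
  have : ‖x‖ = 1 := by simpa [S3] using hx
  simp [radialExtension, this]

/-- The derivative of a map homogeneous of degree one is homogeneous of degree zero. Jacobians on S³
can thus be read off on any concentric sphere. -/
theorem fderiv_radialExtension_smul (ψ : R4 → R4) {c : ℝ} (hc : 0 < c) (x : R4) :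
    fderiv ℝ (radialExtension ψ) (c • x) = fderiv ℝ (radialExtension ψ) x := by
  have h : (fun x => radialExtension ψ (c • x)) = fun x => c • radialExtension ψ x :=
    funext (radialExtension_smul ψ hc)
  have h1 := congrArg (fun f => fderiv ℝ f x) h
  rw [fderiv_comp_smul, show (fun x => c • radialExtension ψ x) = c • radialExtension ψ from rfl,
    fderiv_const_smul_field] at h1
  exact smul_right_injective _ hc.ne' h1

theorem inv_norm_smul_mem_S3 {x : R4} (hx : x ≠ 0) : ‖x‖⁻¹ • x ∈ S3 := by
  simp [S3, norm_smul, hx]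

theorem IsSmoothSphereMap.norm_radialExtension {ψ : R4 → R4} (hψ : IsSmoothSphereMap ψ) (x : R4) :
    ‖radialExtension ψ x‖ = ‖x‖ := by
  rcases eq_or_ne x 0 with rfl | hx
  · simp [radialExtension]
  · have : ‖ψ (‖x‖⁻¹ • x)‖ = 1 := by simpa [S3] using hψ.1 (inv_norm_smul_mem_S3 hx)
    simp [radialExtension, norm_smul, this]

theorem IsSmoothSphereMap.contDiffAt_radialExtension {ψ : R4 → R4} (hψ : IsSmoothSphereMap ψ)
    {x : R4} (hx : x ≠ 0) : ContDiffAt ℝ ∞ (radialExtension ψ) x :=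
  hψ.2.contDiffAt (isOpen_compl_singleton.mem_nhds hx)

/-- Sard's theorem for maps from `S³` to `S³`. -/
theorem IsSmoothSphereMap.exists_isRegularValue {ψ : R4 → R4} (hψ : IsSmoothSphereMap ψ) :
    ∃ y, IsRegularValue ψ y := by
  set R := radialExtension ψ
  let s : Set R4 := {x | x ≠ 0 ∧ (fderiv ℝ R x).det = 0}
  have hs : volume (R '' s) = 0 :=
    addHaar_image_eq_zero_of_det_fderivWithin_eq_zero volume (f' := fderiv ℝ R)
      (fun x hx => ((hψ.contDiffAt_radialExtension hx.1).differentiableAt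
        (by norm_num)).hasFDerivAt.hasFDerivWithinAt) fun x hx => hx.2
  have hpos : volume (Metric.ball (0 : R4) 1 \ {0}) ≠ 0 := by
    rw [measure_sdiff_null (measure_singleton _)]
    exact (Metric.measure_ball_pos volume _ one_pos).ne'
  -- Critical points form a cone, so a critical point on S³ over p/‖p‖ would scale to one over p. A
  -- noncritical value p ≠ 0 therefore gives a regular value on the sphere.
  obtain ⟨p, hp, hps⟩ : ∃ p ∈ Metric.ball (0 : R4) 1 \ {0}, p ∉ R '' s := by
    by_contra! h
    exact hpos (measure_mono_null h hs)
  have hp0 : p ≠ 0 := hp.2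
  refine ⟨‖p‖⁻¹ • p, inv_norm_smul_mem_S3 hp0, fun x hx hxy hdet => hps ⟨‖p‖ • x, ⟨?_, ?_⟩, ?_⟩⟩
  · have : x ≠ 0 := by rintro rfl; simp [S3] at hx
    simp [hp0, this]
  · rw [fderiv_radialExtension_smul ψ (norm_pos_iff.2 hp0)]
    exact hdet
  · change radialExtension ψ _ = p
    rw [radialExtension_smul ψ (norm_pos_iff.2 hp0), radialExtension_of_mem hx, hxy,
      smul_inv_smul₀ (norm_ne_zero_iff.2 hp0)]

/-- A smooth map on `ℝ⁴` which agrees with the radial extension of `ψ` away from a small ball. -/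
noncomputable def smoothRadialExtension (ψ : R4 → R4) (x : R4) : R4 :=
  (1 - (⟨1 / 8, 1 / 4, by norm_num, by norm_num⟩ : ContDiffBump (0 : R4)) x) • radialExtension ψ x

theorem smoothRadialExtension_of_le (ψ : R4 → R4) {x : R4} (hx : 1 / 4 ≤ ‖x‖) :
    smoothRadialExtension ψ x = radialExtension ψ x := by
  unfold smoothRadialExtension
  rw [ContDiffBump.zero_of_le_dist _ (by simpa using hx), sub_zero, one_smul]

theorem norm_smoothRadialExtension_le {ψ : R4 → R4} (hψ : IsSmoothSphereMap ψ) (x : R4) :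
    ‖smoothRadialExtension ψ x‖ ≤ ‖x‖ := by
  unfold smoothRadialExtension
  rw [norm_smul, hψ.norm_radialExtension, Real.norm_of_nonneg
    (sub_nonneg.2 (ContDiffBump.le_one _))]
  exact mul_le_of_le_one_left (norm_nonneg _) (sub_le_self _ (ContDiffBump.nonneg _))

theorem IsSmoothSphereMap.contDiff_smoothRadialExtension {ψ : R4 → R4}
    (hψ : IsSmoothSphereMap ψ) : ContDiff ℝ ∞ (smoothRadialExtension ψ) := by
  rw [contDiff_iff_contDiffAt]
  intro x
  rcases eq_or_ne x 0 with rfl | hx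
  · refine (contDiffAt_const (c := (0 : R4))).congr_of_eventuallyEq ?_
    filter_upwards [Metric.closedBall_mem_nhds (0 : R4) (ε := 1 / 8) (by norm_num)] with y hy
    unfold smoothRadialExtension
    rw [ContDiffBump.one_of_mem_closedBall _ hy, sub_self, zero_smul]
  · exact (contDiffAt_const.sub (ContDiffBump.contDiff _).contDiffAt).smul
      (hψ.contDiffAt_radialExtension hx)

/-- Smoothing does not raise norms above ‖v‖, so a solution has ‖v‖ ≥ 1/2. It lies outside the
modified ball of radius 1/4, where the map preserves norms and is homogeneous. -/
theorem IsSmoothSphereMap.smoothRadialExtension_eq_iff {ψ : R4 → R4} (hψ : IsSmoothSphereMap ψ)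
    {y : R4} (hy : y ∈ S3) (v : R4) :
    smoothRadialExtension ψ v = (1 / 2 : ℝ) • y ↔ ∃ x ∈ S3, ψ x = y ∧ (1 / 2 : ℝ) • x = v := by
  have hy1 : ‖y‖ = 1 := by simpa [S3] using hy
  constructor
  · intro h
    have hn : ‖smoothRadialExtension ψ v‖ = 1 / 2 := by rw [h, norm_smul, hy1]; norm_num
    have hv := norm_smoothRadialExtension_le hψ v
    have hR := smoothRadialExtension_of_le ψ (x := v) (by linarith)
    have hv2 : ‖v‖ = 1 / 2 := by rw [← hn, hR, hψ.norm_radialExtension]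
    have hx : (2 : ℝ) • v ∈ S3 := by simp [S3, norm_smul, hv2]
    refine ⟨(2 : ℝ) • v, hx, ?_, by rw [smul_smul]; norm_num⟩
    rw [← radialExtension_of_mem (ψ := ψ) hx, radialExtension_smul ψ two_pos, ← hR, h, smul_smul]
    norm_num
  · rintro ⟨x, hx, rfl, rfl⟩
    have hx1 : ‖x‖ = 1 := by simpa [S3] using hx
    rw [smoothRadialExtension_of_le, radialExtension_smul ψ (by norm_num), radialExtension_of_mem hx]
    rw [norm_smul, hx1]
    norm_num

/-- The degree integral of a map of a ball in `ℝ⁴` is the number of preimages, counted with signs,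
of a regular value of the normalized map on the sphere. -/
theorem IsRegularValue.eventually_degreeIntegral_eq_finsum {ψ φ : R4 → R4}
    (hψ : IsSmoothSphereMap ψ) {y : R4} (hy : IsRegularValue ψ y) (hφ : ContDiff ℝ 2 φ) (P : R4)
    {ε : ℝ} (hε : 0 < ε) (h0 : ∀ x ∈ Metric.sphere P ε, φ x ≠ 0)
    (hφψ : ∀ u ∈ S3, ψ u = ‖φ (P + ε • u)‖⁻¹ • φ (P + ε • u)) :
    {x | x ∈ S3 ∧ ψ x = y}.Finite ∧ ∀ᶠ r in 𝓝[>] (0 : ℝ), ∀ η : R4 → ℝ, ContDiff ℝ 1 η →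
      tsupport η ⊆ Metric.ball 0 r → ∫ x, η x = 1 →
      degreeIntegral volume η φ (Metric.ball P ε) =
        ((∑ᶠ x ∈ {x | x ∈ S3 ∧ ψ x = y},
          ((SignType.sign (tangentDet ψ x) : SignType) : ℤ) : ℤ) : ℝ) := by
  have hy1 : ‖y‖ = 1 := by simpa [S3] using hy.1
  set T := {x | x ∈ S3 ∧ ψ x = y} with hT
  -- Φ equals φ/‖φ‖ on the sphere about P. Subtracting y/2 moves the zeros to the sphere of half the
  -- radius, one at j x for each preimage x of y.
  let Φ : R4 → R4 := fun x => smoothRadialExtension ψ (ε⁻¹ • (x - P))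
  let Φ' : R4 → R4 := fun x => Φ x - (1 / 2 : ℝ) • y
  let j : R4 → R4 := fun x => P + (ε / 2) • x
  have hj : ∀ x, ε⁻¹ • (j x - P) = (1 / 2 : ℝ) • x := by
    intro x
    simp only [j, add_sub_cancel_left, smul_smul]
    congr 1
    field_simp
  have hjinj : Injective j := fun x x' h => by
    have := hj x
    rw [h, hj] at this
    exact (smul_right_injective _ (by norm_num) this).symm
  have hΦ : ContDiff ℝ ∞ Φ :=
    hψ.contDiff_smoothRadialExtension.comp ((contDiff_id.sub contDiff_const).const_smul _)
  have hΦ' : ContDiff ℝ ∞ Φ' := hΦ.sub contDiff_const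
  have hfd : ∀ x ∈ S3, fderiv ℝ Φ' (j x) = ε⁻¹ • fderiv ℝ (radialExtension ψ) x := by
    intro x hx
    have hx1 : ‖x‖ = 1 := by simpa [S3] using hx
    have hx0 : (1 / 2 : ℝ) • x ≠ 0 := by
      rw [← norm_ne_zero_iff, norm_smul, hx1]; norm_num
    have h1 : HasFDerivAt (smoothRadialExtension ψ) (fderiv ℝ (radialExtension ψ) x)
        (ε⁻¹ • (j x - P)) := by
      rw [hj, ← fderiv_radialExtension_smul ψ (c := 1 / 2) (by norm_num)]
      refine ((hψ.contDiffAt_radialExtension hx0).differentiableAt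
        (by norm_num)).hasFDerivAt.congr_of_eventuallyEq ?_
      have : ∀ᶠ z in 𝓝 ((1 / 2 : ℝ) • x), 1 / 4 < ‖z‖ :=
        continuous_norm.continuousAt.eventually
          (lt_mem_nhds (by beta_reduce; rw [norm_smul, hx1]; norm_num))
      filter_upwards [this] with z hz using smoothRadialExtension_of_le ψ hz.le
    have h2 : HasFDerivAt (fun z : R4 => ε⁻¹ • (z - P)) (ε⁻¹ • ContinuousLinearMap.id ℝ R4) (j x) :=
      ((hasFDerivAt_id _).sub_const P).const_smul ε⁻¹
    have h3 := ((h1.comp (j x) h2).sub_const ((1 / 2 : ℝ) • y)).fderiv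
    rw [ContinuousLinearMap.comp_smul, ContinuousLinearMap.comp_id] at h3
    exact h3
  have hsign : ∀ x ∈ S3, SignType.sign (fderiv ℝ Φ' (j x)).det = SignType.sign (tangentDet ψ x) := by
    intro x hx
    rw [hfd x hx, tangentDet]
    have : (ε⁻¹ • fderiv ℝ (radialExtension ψ) x).det =
        ε⁻¹ ^ finrank ℝ R4 * (fderiv ℝ (radialExtension ψ) x).det := LinearMap.det_smul _ _
    rw [this, sign_mul, sign_pos (by positivity), one_mul]
  have hzero : ∀ x, Φ' x = 0 ↔ x ∈ j '' T := by
    intro x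
    simp only [Φ', Φ, sub_eq_zero, hψ.smoothRadialExtension_eq_iff hy.1, hT, mem_image,
      mem_ofPred_eq, and_assoc]
    refine exists_congr fun z => and_congr_right fun _ => and_congr_right fun _ => ?_
    rw [← hj z]
    constructor
    · exact fun h => sub_left_injective (smul_right_injective _ (inv_ne_zero hε.ne') h)
    · rintro rfl; rfl
  have hjball : ∀ x ∈ T, j x ∈ Metric.ball P ε := by
    intro x hx
    have hx1 : ‖x‖ = 1 := by simpa [S3] using hx.1
    rw [mem_ball_iff_norm, add_sub_cancel_left, norm_smul, hx1,
      Real.norm_of_nonneg (by positivity)]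
    linarith
  have hdet : ∀ x ∈ T, (fderiv ℝ Φ' (j x)).det ≠ 0 := by
    intro x hx
    rw [← sign_ne_zero, hsign x hx.1, sign_ne_zero]
    exact hy.2 x hx.1 hx.2
  have hfin : T.Finite := by
    have h := (hΦ'.of_le (m := 1) (by norm_num)).finite_zeros_of_det_ne_zero
      (isCompact_closedBall P ε) (by
        intro x _ hx
        obtain ⟨z, hz, rfl⟩ := (hzero x).1 hx
        exact hdet z hz)
    refine Finite.of_finite_image (h.subset ?_) hjinj.injOn
    rintro _ ⟨z, hz, rfl⟩
    exact ⟨Metric.ball_subset_closedBall (hjball z hz), (hzero _).2 ⟨z, hz, rfl⟩⟩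
  refine ⟨hfin, ?_⟩
  have hfr : frontier (Metric.ball P ε) = Metric.sphere P ε := frontier_ball P hε.ne'
  have hcount := eventually_degreeIntegral_eq_sum volume (hΦ'.of_le (m := 1) (by norm_num))
    (Metric.isOpen_ball (x := P) (ε := ε)) Metric.isBounded_ball (Z := hfin.toFinset.image j)
    (fun x _ hx => by simpa using (hzero x).1 hx)
    (by simpa using hjball)
    (by
      intro z hz
      exact (hzero z).2 (by simpa using hz))
    (by simpa using hdet)
  have hΦS : ∀ x ∈ Metric.sphere P ε, Φ x = ‖φ x‖⁻¹ • φ x := by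
    intro x hx
    have hxn : ‖x - P‖ = ε := by simpa [dist_eq_norm] using hx
    have hu : ε⁻¹ • (x - P) ∈ S3 := by
      simp [S3, norm_smul, hxn, abs_of_pos hε, hε.ne']
    have hu1 : ‖ε⁻¹ • (x - P)‖ = 1 := by simpa [S3] using hu
    simp only [Φ]
    rw [smoothRadialExtension_of_le ψ (by rw [hu1]; norm_num), radialExtension_of_mem hu, hφψ _ hu,
      smul_inv_smul₀ hε.ne', add_sub_cancel]
  filter_upwards [hcount, (isCompact_sphere P ε).eventually_lt_norm hφ.continuous.continuousOn h0,
    Ioo_mem_nhdsGT (show (0 : ℝ) < 1 / 2 by norm_num)] with r hr hrφ hr1 η hη hηr hη1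
  -- Two linear homotopies, from φ to Φ and from Φ to Φ'. On the boundary the first stays on the ray
  -- through φ with norm (1 − t)‖φ‖ + t, and the second moves the unit vector Φ by at most 1/2; both
  -- norms exceed r.
  rw [degreeIntegral_eq_of_homotopy volume hη hφ (hΦ.of_le (by norm_cast))
    Metric.isOpen_ball Metric.isBounded_ball (ψ := Φ) ?_,
    degreeIntegral_eq_of_homotopy volume hη (hΦ.of_le (by norm_cast))
    (hΦ'.of_le (by norm_cast))
    Metric.isOpen_ball Metric.isBounded_ball (ψ := Φ') ?_,
    hr η hη.continuous ((subset_tsupport η).trans hηr) hη1,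
    Finset.sum_image fun _ _ _ _ h => hjinj h, finsum_mem_eq_finite_toFinset_sum _ hfin]
  · push_cast
    refine Finset.sum_congr rfl fun x hx => ?_
    rw [hsign x (by simpa using (hfin.mem_toFinset.1 hx).1)]
  · intro x hx t ht hmem
    rw [hfr] at hx
    have h2 := mem_ball_zero_iff.1 (hηr hmem)
    have hn : ‖Φ x‖ = 1 := by
      rw [hΦS x hx, norm_smul, norm_inv, norm_norm, inv_mul_cancel₀ (norm_ne_zero_iff.2 (h0 x hx))]
    have h3 : ‖t • (Φ' x - Φ x)‖ ≤ 1 / 2 := by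
      simp only [Φ', sub_sub_cancel_left, norm_smul, norm_neg, hy1, Real.norm_of_nonneg ht.1]
      norm_num
      linarith [ht.2]
    have h4 := norm_sub_le (Φ x + t • (Φ' x - Φ x)) (t • (Φ' x - Φ x))
    rw [add_sub_cancel_right, hn] at h4
    linarith [hr1.2]
  · intro x hx t ht hmem
    rw [hfr] at hx
    have h2 := mem_ball_zero_iff.1 (hηr hmem)
    have hx0 := norm_pos_iff.2 (h0 x hx)
    have h3 : φ x + t • (Φ x - φ x) = ((1 - t) + t * ‖φ x‖⁻¹) • φ x := by
      rw [hΦS x hx]; module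
    rw [h3, norm_smul, Real.norm_of_nonneg (add_nonneg (sub_nonneg.2 ht.2) (mul_nonneg ht.1 (by positivity))), add_mul,
      mul_assoc, inv_mul_cancel₀ hx0.ne'] at h2
    have h4 := hrφ x hx
    nlinarith [ht.1, ht.2, hr1.2]

/-! ### Mixed polynomials and the real differential -/

theorem contDiff_toC2 (j : Fin 2) : ContDiff ℝ ∞ fun x : R4 => toC2 x j := by
  have h : ∀ k l : Fin 4, ContDiff ℝ ∞ fun x : R4 => (⟨x k, x l⟩ : ℂ) := by
    intro k l
    have : (fun x : R4 => (⟨x k, x l⟩ : ℂ)) =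
        fun x => Complex.equivRealProdCLM.symm (x k, x l) := rfl
    rw [this]
    exact Complex.equivRealProdCLM.symm.contDiff.comp (by fun_prop)
  fin_cases j
  · exact h 0 1
  · exact h 2 3

theorem MixedPolynomial.contDiff_value (f : MixedPolynomial) : ContDiff ℝ ∞ f.value := by
  have hX : ∀ i : Fin 2 ⊕ Fin 2, ContDiff ℝ ∞ fun x : R4 =>
      (Sum.elim (fun j => toC2 x j) (fun j => conj (toC2 x j)) i : ℂ) := by
    rintro (j | j)
    · exact contDiff_toC2 j
    · exact Complex.conjCLE.contDiff.comp (contDiff_toC2 j)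
  unfold MixedPolynomial.value
  induction f using MvPolynomial.induction_on with
  | C a => simpa using contDiff_const
  | add p q hp hq => simpa only [map_add] using hp.add hq
  | mul_X p i hp => simpa only [map_mul, MvPolynomial.eval_X] using hp.mul (hX i)

theorem contDiff_realMap (f g : MixedPolynomial) : ContDiff ℝ ∞ (realMap f g) := by
  rw [contDiff_euclidean]
  have hre : ∀ f : MixedPolynomial, ContDiff ℝ ∞ fun x => (f.value x).re := fun f =>
    Complex.reCLM.contDiff.comp f.contDiff_value
  have him : ∀ f : MixedPolynomial, ContDiff ℝ ∞ fun x => (f.value x).im := fun f =>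
    Complex.imCLM.contDiff.comp f.contDiff_value
  intro i
  fin_cases i
  exacts [hre f, him f, hre g, him g]

theorem realMap_eq_zero_iff {f g : MixedPolynomial} {x : R4} :
    realMap f g x = 0 ↔ x ∈ curve f ∩ curve g := by
  simp only [curve, mem_inter_iff, Set.mem_ofPred_eq, Complex.ext_iff, Complex.zero_re,
    Complex.zero_im]
  constructor
  · intro h
    have h' : ∀ i, realMap f g x i = 0 := fun i => by rw [h]; rfl
    exact ⟨⟨h' 0, h' 1⟩, ⟨h' 2, h' 3⟩⟩
  · rintro ⟨⟨h0, h1⟩, ⟨h2, h3⟩⟩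
    ext i
    fin_cases i
    exacts [h0, h1, h2, h3]

theorem MixedPolynomial.hasFDerivAt_value (f : MixedPolynomial) (P : R4) :
    HasFDerivAt f.value (fderiv ℝ f.value P) P :=
  (f.contDiff_value.differentiable (by norm_num) P).hasFDerivAt

theorem inner_gradRe (f : MixedPolynomial) (P v : R4) :
    ⟪gradRe f P, v⟫ = (fderiv ℝ f.value P v).re := by
  rw [gradRe, gradient, InnerProductSpace.toDual_symm_apply]
  exact DFunLike.congr_fun (Complex.reCLM.hasFDerivAt.comp P (f.hasFDerivAt_value P)).fderiv v

theorem inner_gradIm (f : MixedPolynomial) (P v : R4) :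
    ⟪gradIm f P, v⟫ = (fderiv ℝ f.value P v).im := by
  rw [gradIm, gradient, InnerProductSpace.toDual_symm_apply]
  exact DFunLike.congr_fun (Complex.imCLM.hasFDerivAt.comp P (f.hasFDerivAt_value P)).fderiv v

theorem mem_tangentPlane_iff {f : MixedPolynomial} {P v : R4} :
    v ∈ tangentPlane f P ↔ ⟪gradRe f P, v⟫ = 0 ∧ ⟪gradIm f P, v⟫ = 0 := by
  rw [inner_gradRe, inner_gradIm, tangentPlane, LinearMap.mem_ker]
  exact Complex.ext_iff

theorem fderiv_realMap_apply (f g : MixedPolynomial) (P v : R4) (i : Fin 4) :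
    fderiv ℝ (realMap f g) P v i =
      ⟪(![gradRe f P, gradIm f P, gradRe g P, gradIm g P] : Fin 4 → R4) i, v⟫ := by
  have h := ((EuclideanSpace.proj (𝕜 := ℝ) i).hasFDerivAt.comp P
    ((contDiff_realMap f g).differentiable (by norm_num) P).hasFDerivAt).fderiv
  have h1 : fderiv ℝ (realMap f g) P v i = fderiv ℝ (fun x => realMap f g x i) P v :=
    (DFunLike.congr_fun h v).symm
  rw [h1]
  fin_cases i
  · exact (DFunLike.congr_fun (Complex.reCLM.hasFDerivAt.comp P (f.hasFDerivAt_value P)).fderiv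
      v).trans (inner_gradRe f P v).symm
  · exact (DFunLike.congr_fun (Complex.imCLM.hasFDerivAt.comp P (f.hasFDerivAt_value P)).fderiv
      v).trans (inner_gradIm f P v).symm
  · exact (DFunLike.congr_fun (Complex.reCLM.hasFDerivAt.comp P (g.hasFDerivAt_value P)).fderiv
      v).trans (inner_gradRe g P v).symm
  · exact (DFunLike.congr_fun (Complex.imCLM.hasFDerivAt.comp P (g.hasFDerivAt_value P)).fderiv
      v).trans (inner_gradIm g P v).symm

theorem det_fderiv_realMap (f g : MixedPolynomial) (P : R4) :
    (fderiv ℝ (realMap f g) P).det = det4 (gradRe f P) (gradIm f P) (gradRe g P) (gradIm g P) := by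
  rw [ContinuousLinearMap.det, ← LinearMap.det_toMatrix (EuclideanSpace.basisFun (Fin 4) ℝ).toBasis,
    det4, ← Matrix.det_transpose]
  congr 1
  ext i j
  rw [Matrix.transpose_apply, LinearMap.toMatrix_apply]
  simp only [OrthonormalBasis.coe_toBasis, OrthonormalBasis.coe_toBasis_repr_apply,
    EuclideanSpace.basisFun_repr, EuclideanSpace.basisFun_apply, ContinuousLinearMap.coe_coe,
    Matrix.of_apply]
  rw [fderiv_realMap_apply]
  simp [EuclideanSpace.inner_single_right]

/-! ### Intersection signs and the Jacobian determinant -/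

theorem det4_mul_det4 (a w : Fin 4 → R4) :
    det4 (a 0) (a 1) (a 2) (a 3) * det4 (w 0) (w 1) (w 2) (w 3) =
      Matrix.det (Matrix.of fun i j => ⟪a i, w j⟫) := by
  have h : ∀ a : Fin 4 → R4, (![a 0, a 1, a 2, a 3] : Fin 4 → R4) = a := by
    intro a; ext i; fin_cases i <;> rfl
  rw [det4, det4, h, h, ← Matrix.det_transpose, ← Matrix.det_mul]
  congr 1
  ext i j
  simp [Matrix.mul_apply, PiLp.inner_apply, mul_comm]

theorem det_four_of_zero_right (M : Matrix (Fin 4) (Fin 4) ℝ) (h02 : M 0 2 = 0) (h03 : M 0 3 = 0)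
    (h12 : M 1 2 = 0) (h13 : M 1 3 = 0) :
    M.det = (M 0 0 * M 1 1 - M 0 1 * M 1 0) * (M 2 2 * M 3 3 - M 2 3 * M 3 2) := by
  rw [Matrix.det_succ_row_zero]
  simp [Fin.sum_univ_succ, Matrix.det_fin_three, Fin.succAbove, h02, h03, h12, h13]
  ring

theorem det4_swap_pairs (a b c d : R4) : det4 a b c d = det4 c d a b := by
  unfold det4
  rw [Matrix.det_succ_row_zero, Matrix.det_succ_row_zero]
  simp [Fin.sum_univ_succ, Matrix.det_fin_three, Fin.succAbove]
  ring

theorem det4_swap_left (a b c d : R4) : det4 b a c d = -det4 a b c d := by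
  unfold det4
  rw [Matrix.det_succ_row_zero, Matrix.det_succ_row_zero]
  simp [Fin.sum_univ_succ, Matrix.det_fin_three, Fin.succAbove]
  ring

theorem inner_mul_inner_sub_pos {A B : R4} (h : LinearIndependent ℝ ![A, B]) :
    0 < ⟪A, A⟫ * ⟪B, B⟫ - ⟪A, B⟫ * ⟪B, A⟫ := by
  have := (Matrix.posDef_gram_of_linearIndependent (𝕜 := ℝ) h).det_pos
  simpa [Matrix.det_fin_two, Matrix.gram_apply] using this

/-- The matrix of inner products is block triangular. This is what relates gradients to tangent
frames, which are orthogonal to their own gradients. -/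
theorem det4_mul_det4_of_orthogonal_right {a b c d w x y z : R4} (h1 : ⟪a, y⟫ = 0)
    (h2 : ⟪a, z⟫ = 0) (h3 : ⟪b, y⟫ = 0) (h4 : ⟪b, z⟫ = 0) :
    det4 a b c d * det4 w x y z =
      (⟪a, w⟫ * ⟪b, x⟫ - ⟪a, x⟫ * ⟪b, w⟫) * (⟪c, y⟫ * ⟪d, z⟫ - ⟪c, z⟫ * ⟪d, y⟫) :=
  (det4_mul_det4 ![a, b, c, d] ![w, x, y, z]).trans (det_four_of_zero_right _ h1 h2 h3 h4)

theorem det4_mul_det4_of_orthogonal_left {a b c d w x y z : R4} (h1 : ⟪c, w⟫ = 0)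
    (h2 : ⟪c, x⟫ = 0) (h3 : ⟪d, w⟫ = 0) (h4 : ⟪d, x⟫ = 0) :
    det4 a b c d * det4 w x y z =
      (⟪a, w⟫ * ⟪b, x⟫ - ⟪a, x⟫ * ⟪b, w⟫) * (⟪c, y⟫ * ⟪d, z⟫ - ⟪c, z⟫ * ⟪d, y⟫) := by
  rw [det4_swap_pairs a, det4_swap_pairs w, det4_mul_det4_of_orthogonal_right h1 h2 h3 h4, mul_comm]

/-- Two orthonormal tangent vectors followed by the two gradients have nonzero determinant, since
its square is the Gram determinant of the gradients. Exchanging the tangent vectors corrects the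
sign if necessary. -/
theorem exists_isPositiveFrame {f : MixedPolynomial} {P : R4} (hf : MixedNonsingularAt f P) :
    ∃ v₁ v₂, IsPositiveFrame f P v₁ v₂ := by
  have hrank : 2 ≤ finrank ℝ (tangentPlane f P) := by
    have h1 := LinearMap.finrank_range_add_finrank_ker (fderiv ℝ f.value P : R4 →ₗ[ℝ] ℂ)
    have h2 := Submodule.finrank_le (LinearMap.range (fderiv ℝ f.value P : R4 →ₗ[ℝ] ℂ))
    rw [Complex.finrank_real_complex] at h2
    have h3 : finrank ℝ R4 = 4 := finrank_euclideanSpace_fin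
    unfold tangentPlane
    omega
  have hb := (stdOrthonormalBasis ℝ (tangentPlane f P)).orthonormal.comp _
    (Fin.castLE_injective hrank)
  set u : Fin 2 → tangentPlane f P :=
    stdOrthonormalBasis ℝ (tangentPlane f P) ∘ Fin.castLE hrank
  have hin : ∀ i j, ⟪(u i : R4), (u j : R4)⟫ = if i = j then 1 else 0 :=
    orthonormal_iff_ite.1 hb
  have h0 := mem_tangentPlane_iff.1 (u 0).2
  have h1 := mem_tangentPlane_iff.1 (u 1).2
  have hsq : 0 < det4 (u 0) (u 1) (gradRe f P) (gradIm f P) *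
      det4 (u 0) (u 1) (gradRe f P) (gradIm f P) := by
    rw [det4_mul_det4_of_orthogonal_left h0.1 h1.1 h0.2 h1.2]
    refine mul_pos ?_ (inner_mul_inner_sub_pos hf.2)
    rw [hin, hin, hin, hin]
    simp
  rcases (mul_self_pos.1 hsq).lt_or_gt with h | h
  · exact ⟨u 1, u 0, (u 1).2, (u 0).2, by rw [det4_swap_left]; exact neg_pos.2 h⟩
  · exact ⟨u 0, u 1, (u 0).2, (u 1).2, h⟩

theorem TransverseAt.det_ne_zero {f g : MixedPolynomial} {P : R4} (h : TransverseAt f g P) :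
    det4 (gradRe f P) (gradIm f P) (gradRe g P) (gradIm g P) ≠ 0 := by
  obtain ⟨hf, hg, htop⟩ := h
  intro h0
  rw [det4, ← Matrix.exists_mulVec_eq_zero_iff] at h0
  obtain ⟨c, hc, h0⟩ := h0
  have hsum : c 0 • gradRe f P + c 1 • gradIm f P + (c 2 • gradRe g P + c 3 • gradIm g P) = 0 := by
    ext i
    have := congrFun h0 i
    simp only [Matrix.mulVec, dotProduct, Fin.sum_univ_four, Matrix.of_apply, Matrix.cons_val,
      Pi.zero_apply] at this
    simp only [PiLp.add_apply, PiLp.smul_apply, smul_eq_mul, PiLp.zero_apply]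
    linarith
  -- A linear relation among the four gradients gives a vector w normal to both tangent planes.
  -- These span ℝ⁴, so w = 0 and the relation splits into one for f and one for g.
  set w := c 0 • gradRe f P + c 1 • gradIm f P with hw
  have hw' : w = -(c 2 • gradRe g P + c 3 • gradIm g P) := eq_neg_of_add_eq_zero_left hsum
  have hwf : tangentPlane f P ≤ LinearMap.ker (innerₛₗ ℝ w) := fun x hx => by
    obtain ⟨h1, h2⟩ := mem_tangentPlane_iff.1 hx
    simp [hw, h1, h2]
  have hwg : tangentPlane g P ≤ LinearMap.ker (innerₛₗ ℝ w) := fun x hx => by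
    obtain ⟨h1, h2⟩ := mem_tangentPlane_iff.1 hx
    simp [hw', h1, h2]
  have hw0 : w = 0 := by
    have : w ∈ LinearMap.ker (innerₛₗ ℝ w) := (htop ▸ sup_le hwf hwg) (Submodule.mem_top (x := w))
    simpa using this
  have hf0 := LinearIndependent.pair_iff.1 hf.2 _ _ hw0
  have hg0 := LinearIndependent.pair_iff.1 hg.2 (c 2) (c 3) (by rw [← neg_eq_zero, ← hw', hw0])
  apply hc
  ext i
  fin_cases i
  exacts [hf0.1, hf0.2, hg0.1, hg0.2]

/-- For positive frames of the two tangent planes, the sign of their determinant is the sign of the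
Jacobian determinant. -/
theorem TransverseAt.det4_mul_det4_pos {f g : MixedPolynomial} {P u₁ u₂ v₁ v₂ : R4}
    (h : TransverseAt f g P) (hu : IsPositiveFrame f P u₁ u₂) (hv : IsPositiveFrame g P v₁ v₂) :
    0 < det4 (gradRe f P) (gradIm f P) (gradRe g P) (gradIm g P) * det4 u₁ u₂ v₁ v₂ := by
  obtain ⟨hu1, hu2, hu0⟩ := hu
  obtain ⟨hv1, hv2, hv0⟩ := hv
  rw [mem_tangentPlane_iff] at hu1 hu2 hv1 hv2
  have hJ := h.det_ne_zero
  have hA := inner_mul_inner_sub_pos h.1.2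
  have hC := inner_mul_inner_sub_pos h.2.1.2
  have e1 := det4_mul_det4_of_orthogonal_right (c := gradRe g P) (d := gradIm g P)
    (w := gradRe f P) (x := gradIm f P) hu1.1 hu2.1 hu1.2 hu2.2
  have e2 := det4_mul_det4_of_orthogonal_left (a := gradRe f P) (b := gradIm f P)
    (y := gradRe g P) (z := gradIm g P) hv1.1 hv2.1 hv1.2 hv2.2
  have e3 := det4_mul_det4_of_orthogonal_right (c := gradRe g P) (d := gradIm g P)
    (w := v₁) (x := v₂) hu1.1 hu2.1 hu1.2 hu2.2
  rw [← det4_swap_pairs u₁] at e1 e3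
  rw [e3]
  set J := det4 (gradRe f P) (gradIm f P) (gradRe g P) (gradIm g P)
  set X := ⟪gradRe f P, v₁⟫ * ⟪gradIm f P, v₂⟫ - ⟪gradRe f P, v₂⟫ * ⟪gradIm f P, v₁⟫
  set Y := ⟪gradRe g P, u₁⟫ * ⟪gradIm g P, u₂⟫ - ⟪gradRe g P, u₂⟫ * ⟪gradIm g P, u₁⟫
  set α := det4 u₁ u₂ (gradRe f P) (gradIm f P)
  set β := det4 v₁ v₂ (gradRe g P) (gradIm g P)
  set Gf := ⟪gradRe f P, gradRe f P⟫ * ⟪gradIm f P, gradIm f P⟫ -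
    ⟪gradRe f P, gradIm f P⟫ * ⟪gradIm f P, gradRe f P⟫
  set Gg := ⟪gradRe g P, gradRe g P⟫ * ⟪gradIm g P, gradIm g P⟫ -
    ⟪gradRe g P, gradIm g P⟫ * ⟪gradIm g P, gradRe g P⟫
  -- The three identities read Jα = Gf·Y, Jβ = X·Gg and J·det(u₁, u₂, v₁, v₂) = X·Y. Since α, β, Gf
  -- and Gg are positive, multiplying the first two shows X·Y > 0.
  have hprod : 0 < (X * Gg) * (Gf * Y) := by
    rw [← e1, ← e2, show J * β * (J * α) = J * J * (β * α) by ring]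
    exact mul_pos (mul_self_pos.2 hJ) (mul_pos hv0 hu0)
  rw [show X * Gg * (Gf * Y) = Gg * Gf * (X * Y) by ring] at hprod
  exact (mul_pos_iff_of_pos_left (mul_pos hC hA)).1 hprod

theorem TransverseAt.isPositiveIntersection_iff {f g : MixedPolynomial} {P : R4}
    (h : TransverseAt f g P) :
    IsPositiveIntersection f g P ↔ 0 < (fderiv ℝ (realMap f g) P).det := by
  rw [det_fderiv_realMap]
  constructor
  · rintro ⟨-, u₁, u₂, v₁, v₂, hu, hv, hpos⟩
    exact (pos_iff_pos_of_mul_pos (h.det4_mul_det4_pos hu hv)).2 hpos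
  · intro hJ
    obtain ⟨u₁, u₂, hu⟩ := exists_isPositiveFrame h.1
    obtain ⟨v₁, v₂, hv⟩ := exists_isPositiveFrame h.2.1
    exact ⟨h, u₁, u₂, v₁, v₂, hu, hv,
      (pos_iff_pos_of_mul_pos (h.det4_mul_det4_pos hu hv)).1 hJ⟩

theorem TransverseAt.isNegativeIntersection_iff {f g : MixedPolynomial} {P : R4}
    (h : TransverseAt f g P) :
    IsNegativeIntersection f g P ↔ (fderiv ℝ (realMap f g) P).det < 0 := by
  rw [det_fderiv_realMap]
  constructor
  · rintro ⟨-, u₁, u₂, v₁, v₂, hu, hv, hneg⟩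
    exact (neg_iff_neg_of_mul_pos (h.det4_mul_det4_pos hu hv)).2 hneg
  · intro hJ
    obtain ⟨u₁, u₂, hu⟩ := exists_isPositiveFrame h.1
    obtain ⟨v₁, v₂, hv⟩ := exists_isPositiveFrame h.2.1
    exact ⟨h, u₁, u₂, v₁, v₂, hu, hv,
      (neg_iff_neg_of_mul_pos (h.det4_mul_det4_pos hu hv)).1 hJ⟩

/-- The numbers of indices with positive and with negative value add up to the number of indices if
no value is zero, and their difference is the sum of the signs. -/
theorem ncard_pos_neg {ν : ℕ} (s : Fin ν → ℝ) (hs : ∀ j, s j ≠ 0) :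
    {j | 0 < s j}.ncard + {j | s j < 0}.ncard = ν ∧
      ∑ j, ((SignType.sign (s j) : SignType) : ℝ) =
        ({j | 0 < s j}.ncard : ℝ) - ({j | s j < 0}.ncard : ℝ) := by
  classical
  have hp : {j | 0 < s j}.ncard = (Finset.univ.filter fun j => 0 < s j).card := by
    rw [← ncard_coe_finset]; simp
  have hn : {j | s j < 0}.ncard = (Finset.univ.filter fun j => s j < 0).card := by
    rw [← ncard_coe_finset]; simp
  have hcompl : (Finset.univ.filter fun j => s j < 0) = Finset.univ.filter fun j => ¬0 < s j := by
    ext j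
    simp only [Finset.mem_filter, Finset.mem_univ, true_and, not_lt]
    exact ⟨le_of_lt, fun h => h.lt_of_ne (hs j)⟩
  constructor
  · rw [hp, hn, hcompl, Finset.card_filter_add_card_filter_not, Finset.card_univ, Fintype.card_fin]
  · have hsign : ∀ j, ((SignType.sign (s j) : SignType) : ℝ) =
        (if 0 < s j then 1 else 0) - (if s j < 0 then 1 else 0) := by
      intro j
      rcases (hs j).lt_or_gt with h | h
      · simp [h, h.not_gt]
      · simp [h, h.not_gt]
    simp only [hsign, Finset.sum_sub_distrib, Finset.sum_boole, hp, hn]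

/-! ### The normalized map and the choice of the isolating radius -/

theorem isSmoothSphereMap_normalizedMap {f g : MixedPolynomial} {P : R4} {ε : ℝ} (hε : 0 < ε)
    (h0 : ∀ x ∈ Metric.sphere P ε, realMap f g x ≠ 0) :
    IsSmoothSphereMap (normalizedMap f g P ε) := by
  have hS : ∀ u ∈ S3, P + ε • u ∈ Metric.sphere P ε := by
    intro u hu
    have : ‖u‖ = 1 := by simpa [S3] using hu
    simp [norm_smul, this, hε.le]
  refine ⟨fun u hu => inv_norm_smul_mem_S3 (h0 _ (hS u hu)), fun x hx => ?_⟩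
  have hn : ContDiffAt ℝ ∞ (fun x : R4 => ‖x‖) x := contDiffAt_norm ℝ hx
  have hu : ContDiffAt ℝ ∞ (fun x : R4 => ‖x‖⁻¹ • x) x :=
    (hn.inv (norm_ne_zero_iff.2 hx)).smul contDiffAt_id
  have hφ : ContDiffAt ℝ ∞ (fun x : R4 => realMap f g (P + ε • (‖x‖⁻¹ • x))) x :=
    (contDiff_realMap f g).contDiffAt.comp x (contDiffAt_const.add (hu.const_smul ε))
  have hne := h0 _ (hS _ (inv_norm_smul_mem_S3 hx))
  exact (hn.smul (((hφ.norm ℝ hne).inv (norm_ne_zero_iff.2 hne)).smul hφ)).contDiffWithinAt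

theorem IsIsolatingRadius.realMap_ne_zero {f g : MixedPolynomial} {P : R4} {ε : ℝ}
    (h : IsIsolatingRadius f g P ε) {x : R4} (hx : x ∈ Metric.closedBall P ε) (hxP : x ≠ P) :
    realMap f g x ≠ 0 := by
  intro h0
  have : x ∈ curve f ∩ curve g ∩ Metric.closedBall P ε := ⟨realMap_eq_zero_iff.1 h0, hx⟩
  rw [h.2] at this
  exact hxP this

theorem IsIsolatingRadius.realMap_ne_zero_of_mem_sphere {f g : MixedPolynomial} {P : R4} {ε : ℝ}
    (h : IsIsolatingRadius f g P ε) {x : R4} (hx : x ∈ Metric.sphere P ε) :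
    realMap f g x ≠ 0 :=
  h.realMap_ne_zero (Metric.sphere_subset_closedBall hx) (Metric.ne_of_mem_sphere hx h.1.ne')

/-- The larger closed ball contains no zero besides P, and P lies in the smaller ball, so excision
applies. The degree for any isolating radius can thus be computed on the ball where the deformation
is controlled. -/
theorem IsIsolatingRadius.eventually_degreeIntegral_eq {f g : MixedPolynomial} {P : R4} {ε ε' : ℝ}
    (h : IsIsolatingRadius f g P ε) (h' : IsIsolatingRadius f g P ε') :
    ∀ᶠ r in 𝓝[>] (0 : ℝ), ∀ η : R4 → ℝ, support η ⊆ Metric.ball 0 r →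
      degreeIntegral volume η (realMap f g) (Metric.ball P ε) =
        degreeIntegral volume η (realMap f g) (Metric.ball P ε') := by
  wlog hle : ε ≤ ε' generalizing ε ε'
  · filter_upwards [this h' h (le_of_not_ge hle)] with r hr η hη using (hr η hη).symm
  refine eventually_degreeIntegral_eq_of_subset volume (contDiff_realMap f g).continuous
    Metric.isOpen_ball Metric.isOpen_ball.measurableSet Metric.isBounded_ball
    (Metric.ball_subset_ball hle) fun x hx hxU => h'.realMap_ne_zero
      (Metric.closure_ball_subset_closedBall hx) ?_
  rintro rfl
  exact hxU (Metric.mem_ball_self h.1)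

end MixedCurve

/-! ### The local intersection number as a signed count -/

open MixedCurve in
theorem mainTheorem3 {𝕜 : Type*} [RCLike 𝕜]
    (f g : MixedCurve.MixedPolynomial) (P : MixedCurve.R4)
    (ρ : ℝ) (F G : 𝕜 → MixedCurve.MixedPolynomial)
    (hF : MixedCurve.IsContinuousFamily ρ F) (hG : MixedCurve.IsContinuousFamily ρ G)
    (hF0 : F 0 = f) (hG0 : G 0 = g)
    (ε : ℝ) (hε : 0 < ε)
    (hP : MixedCurve.curve f ∩ MixedCurve.curve g ∩ Metric.closedBall P ε = {P})
    (γ : ℝ) (hγ : 0 < γ) (hγρ : γ ≤ ρ)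
    (hsphere : ∀ α β : 𝕜, ‖α‖ ≤ γ → ‖β‖ ≤ γ →
      MixedCurve.curve (F α) ∩ MixedCurve.curve (G β) ∩ Metric.sphere P ε = ∅)
    (δ δ' : 𝕜) (hδ : ‖δ‖ ≤ γ) (hδ' : ‖δ'‖ ≤ γ)
    (ν : ℕ) (Q : Fin ν → MixedCurve.R4) (hQinj : Function.Injective Q)
    (hQ : MixedCurve.curve (F δ) ∩ MixedCurve.curve (G δ') ∩ Metric.closedBall P ε = Set.range Q)
    (htrans : ∀ j, MixedCurve.TransverseAt (F δ) (G δ') (Q j))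
    (a b : ℕ)
    (ha : a = Set.ncard {j | MixedCurve.IsPositiveIntersection (F δ) (G δ') (Q j)})
    (hb : b = Set.ncard {j | MixedCurve.IsNegativeIntersection (F δ) (G δ') (Q j)}) :
    a + b = ν ∧ MixedCurve.HasLocalIntersectionNumber f g P ((a : ℤ) - (b : ℤ)) := by
  have hiso : IsIsolatingRadius f g P ε := ⟨hε, hP⟩
  have hdet : ∀ j, (fderiv ℝ (realMap (F δ) (G δ')) (Q j)).det ≠ 0 := fun j => by
    rw [det_fderiv_realMap]; exact (htrans j).det_ne_zero
  obtain ⟨hab, hsum⟩ := ncard_pos_neg _ hdet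
  simp only [(htrans _).isPositiveIntersection_iff] at ha
  simp only [(htrans _).isNegativeIntersection_iff] at hb
  rw [← ha, ← hb] at hab hsum
  refine ⟨hab, ⟨ε, hiso⟩, fun ε' hiso' => ?_⟩
  have hsmooth := isSmoothSphereMap_normalizedMap hiso'.1
    fun x hx => hiso'.realMap_ne_zero_of_mem_sphere hx
  refine ⟨hsmooth, hsmooth.exists_isRegularValue, fun y hy => ?_⟩
  obtain ⟨hfin, hreg⟩ := hy.eventually_degreeIntegral_eq_finsum hsmooth
    ((contDiff_realMap f g).of_le (by norm_cast)) P hiso'.1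
    (fun x hx => hiso'.realMap_ne_zero_of_mem_sphere hx) (fun _ _ => rfl)
  refine ⟨hfin, ?_⟩
  have hfr : frontier (Metric.ball P ε) = Metric.sphere P ε := frontier_ball P hε.ne'
  have hnorm : ∀ (s : unitInterval) (d : 𝕜), ‖d‖ ≤ γ → ‖((s : ℝ) : 𝕜) * d‖ ≤ γ := by
    intro s d hd
    rw [norm_mul, RCLike.norm_ofReal, abs_of_nonneg s.2.1]
    exact (mul_le_of_le_one_left (norm_nonneg _) s.2.2).trans hd
  -- Scaling both parameters by s ∈ [0, 1] keeps them in the disc of radius γ, for real and complex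
  -- parameters alike, so no zero reaches the sphere.
  let Φ : unitInterval → R4 → R4 := fun s =>
    realMap (F (((s : ℝ) : 𝕜) * δ)) (G (((s : ℝ) : 𝕜) * δ'))
  have hvalue : ∀ {H : 𝕜 → MixedPolynomial} {d : 𝕜}, IsContinuousFamily ρ H → ‖d‖ ≤ γ →
      Continuous fun p : unitInterval × R4 => (H (((p.1 : ℝ) : 𝕜) * d)).value p.2 := by
    intro H d hH hd
    refine ContinuousOn.comp_continuous hH
      (f := fun p : unitInterval × R4 => (((p.1 : ℝ) : 𝕜) * d, p.2)) ?_ fun p => ⟨?_, mem_univ _⟩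
    · have : Continuous fun p : unitInterval × R4 => ((p.1 : ℝ) : 𝕜) :=
        RCLike.continuous_ofReal.comp (continuous_subtype_val.comp continuous_fst)
      fun_prop
    · exact mem_closedBall_zero_iff.2 ((hnorm p.1 d hd).trans hγρ)
  have hΦc : Continuous (uncurry Φ) := by
    have h1 := hvalue hF hδ
    have h2 := hvalue hG hδ'
    refine (PiLp.continuous_toLp 2 _).comp (continuous_pi fun i => ?_)
    fin_cases i
    exacts [Complex.continuous_re.comp h1, Complex.continuous_im.comp h1,
      Complex.continuous_re.comp h2, Complex.continuous_im.comp h2]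
  have hΦ0 : ∀ s, ∀ x ∈ frontier (Metric.ball P ε), Φ s x ≠ 0 := by
    intro s x hx h0
    rw [hfr] at hx
    have : x ∈ (∅ : Set R4) := hsphere _ _ (hnorm s δ hδ) (hnorm s δ' hδ') ▸
      (⟨realMap_eq_zero_iff.1 h0, hx⟩ : x ∈ _ ∩ Metric.sphere P ε)
    exact this
  have hhom := eventually_degreeIntegral_eq_of_continuousOn volume (Φ := Φ)
    (fun s => ((contDiff_realMap _ _).of_le (by norm_cast) : ContDiff ℝ 2 (Φ s)))
    Metric.isOpen_ball Metric.isBounded_ball hΦc.continuousOn hΦ0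
  have hΦ_zero : Φ 0 = realMap f g := by simp [Φ, hF0, hG0]
  have hΦ_one : Φ 1 = realMap (F δ) (G δ') := by simp [Φ]
  rw [hΦ_zero, hΦ_one] at hhom
  have hQmem : ∀ x, x ∈ range Q ↔
      x ∈ Metric.closedBall P ε ∧ realMap (F δ) (G δ') x = 0 := by
    intro x
    rw [← hQ, realMap_eq_zero_iff, and_comm]
    rfl
  have hcount := eventually_degreeIntegral_eq_sum volume (φ := realMap (F δ) (G δ'))
    ((contDiff_realMap _ _).of_le (by norm_cast)) (Metric.isOpen_ball (x := P) (ε := ε))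
    Metric.isBounded_ball (Z := Finset.univ.image Q)
    (fun x hx h0 => by
      obtain ⟨j, rfl⟩ := (hQmem x).2 ⟨Metric.closure_ball_subset_closedBall hx, h0⟩
      simp)
    (by
      simp only [Finset.mem_image, Finset.mem_univ, true_and, forall_exists_index,
        forall_apply_eq_imp_iff]
      intro j
      obtain ⟨hj, hj0⟩ := (hQmem _).1 (mem_range_self j)
      rw [← Metric.ball_union_sphere] at hj
      -- The endpoint s = 1 has no zeros on the sphere either, so every Q j lies in the open ball.
      refine hj.resolve_right fun hjS => hΦ0 1 (Q j) (hfr ▸ hjS) ?_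
      rw [hΦ_one, hj0])
    (by
      simp only [Finset.mem_image, Finset.mem_univ, true_and, forall_exists_index,
        forall_apply_eq_imp_iff]
      exact fun j => ((hQmem _).1 (mem_range_self j)).2)
    (by simpa using hdet)
  rw [Finset.sum_image fun _ _ _ _ h => hQinj h, hsum] at hcount
  -- One support radius serves the count over y, the homotopy, the count over the points Q j and the
  -- change from ε' to ε.
  obtain ⟨r, hr1, hr2, hr3, hr4, hr0⟩ := (hreg.and (hhom.and (hcount.and
    ((hiso.eventually_degreeIntegral_eq hiso').and self_mem_nhdsWithin)))).exists
  obtain ⟨η, hη, hηr, hη1⟩ := exists_contDiff_integral_eq_one (volume : Measure R4) hr0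
  have hsupp := (subset_tsupport η).trans hηr
  have key := hr1 η hη hηr hη1
  rw [← hr4 η hsupp, hr2 η hη hηr, hr3 η hη.continuous hsupp hη1] at key
  exact_mod_cast key.symm
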